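/- Let $F^n=(M^n,L)$ be an $n$-dimensional Finsler space with fundamental function $L(x,y)$, where $L$ is defined on an open set $D$ of non-zero tangent vectors that is invariant under positive scaling (for instance the whole slit tangent bundle); that is, $L$ is smooth, positive and positively homogeneous of degree one in $y$ on $D$, and $g_{ij}=\tfrac12\dot\partial_i\dot\partial_jL^2$ is positive definite, where $\dot\partial_i=\partial/\partial y^i$. Let $h_{ij}=g_{ij}-l_il_j$ with $l_i=\dot\partial_iL$, let $C_{ijk}=\tfrac12\dot\partial_ig_{jk}$, and let ${}_{|j}$ and $|_j$ denote the $h$- and $v$-covariant derivatives of the Cartan connection of $F^n$; a subscript $0$ denotes contraction with $y$. Suppose that $F^n$ is a Landsberg space, i.e. $C^r_{ij|0}=0$ on $D$ (equivalently, $F^n$ is a ${}^*\!P$-Finsler space, $C^r_{ij|0}=\lambda\,C^r_{ij}$, with $\lambda=0$). Let $b_i(x,y)$ be a smooth $h$-vector on $D$, i.e. $b_i|_k=0$ and $L\,C^h_{ij}b_h=\rho\,h_{ij}$ for some scalar function $\rho$ (which may vanish), let $\beta=b_i(x,y)\,y^i$, and suppose that ${}^*\!F^n=(M^n,{}^*\!L)$,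 with ${}^*\!L=L\,e^{\beta/L}$, is again a Finsler space on $D$. Let $M^{n-1}$ be an immersed hypersurface of $M^n$, with local parametrizations $x^i=x^i(u^\alpha)$ and projection factors $B^i_\alpha=\partial x^i/\partial u^\alpha$, and let $F^{n-1}$ and ${}^*\!F^{n-1}$ be the hypersurfaces of $F^n$ and ${}^*\!F^n$ that it carries, with the induced fundamental functions. Their line elements are the pairs $(u,v)$ for which $(x(u),\,B^i_\alpha v^\alpha)$ lies in $D$. Let $N^i(u,v)$ be the unit normal vector of $F^{n-1}$, given up to sign by $g_{ij}B^i_\alpha N^j=0$ and $g_{ij}N^iN^j=1$, and let $M_{\alpha\beta}=C_{ijk}B^i_\alpha B^j_\beta N^k$. A hypersurface is called a hyperplane of the second kind if each $h$-path of the hypersurface with respect to its induced Cartan connection is an $h$-path of the ambient Finsler space with respect to the Cartan connection. Here an $h$-path of a connection $(F^i_{jk},N^i_j)$ is a curve $(x(t),y(t))$ of line elements satisfying $\dot y^i+N^i_j\dot x^j=0$ and $\ddot x^i+F^i_{jk}(x,y)\dot x^j\dot x^k=0$. It is called a hyperplane of the third kind if its unit normal vector is parallel, with respect to the Cartan connection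 of the ambient space, along each curve $(u(t),v(t))$ of line elements of the hypersurface. Suppose that $b_i$ is a gradient, i.e. $b_{i|j}=b_{j|i}$, and tangential to $F^{n-1}$, i.e. $b_iN^i=0$. Then: 1. ${}^*\!F^{n-1}$ is a hyperplane of the second kind if $F^{n-1}$ is a hyperplane of the second kind and $M_{\alpha\beta}=0$. 2. ${}^*\!F^{n-1}$ is a hyperplane of the third kind if $F^{n-1}$ is a hyperplane of the third kind. -/

import Mathlib

open scoped Manifold ContDiff

noncomputable section

namespace HExpFinsler

/-! ## Finsler calculus in a coordinate domain

A point `p : Vec n × Vec n` is a line element `(x, y)`: `p.1 = x` is the position and `p.2 = y` the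
supporting element. All tensors below are functions of line elements. -/

/-- Coordinate vectors. -/
abbrev Vec (n : ℕ) : Type := Fin n → ℝ

section Coordinates

variable {n : ℕ}

/-- `∂_i F`, the partial derivative in the position coordinate `x^i`. -/
def dx (i : Fin n) (F : Vec n × Vec n → ℝ) (p : Vec n × Vec n) : ℝ :=
  fderiv ℝ F p (Pi.single i 1, 0)

/-- `∂̇_i F`, the partial derivative in the directional coordinate `y^i`. -/
def dy (i : Fin n) (F : Vec n × Vec n → ℝ) (p : Vec n × Vec n) : ℝ :=
  fderiv ℝ F p (0, Pi.single i 1)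

/-- The metric tensor `g_ij = (1/2) ∂̇_i ∂̇_j L²`. -/
def metric (L : Vec n × Vec n → ℝ) (p : Vec n × Vec n) : Matrix (Fin n) (Fin n) ℝ :=
  Matrix.of fun i j => (1 / 2) * dy i (dy j fun q => L q ^ 2) p

/-- The inverse metric tensor `g^ij`. -/
def metricInv (L : Vec n × Vec n → ℝ) (p : Vec n × Vec n) : Matrix (Fin n) (Fin n) ℝ :=
  (metric L p)⁻¹

/-- The angular metric tensor `h_ij = g_ij - l_i l_j`, where `l_i = ∂̇_i L`. -/
def angular (L : Vec n × Vec n → ℝ) (i j : Fin n) (p : Vec n × Vec n) : ℝ :=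
  metric L p i j - dy i L p * dy j L p

/-- The Cartan tensor `C_ijk = (1/2) ∂̇_i g_jk`. -/
def cartan (L : Vec n × Vec n → ℝ) (i j k : Fin n) (p : Vec n × Vec n) : ℝ :=
  (1 / 2) * dy i (fun q => metric L q j k) p

/-- The components `C^r_ij = g^rs C_sij`. -/
def cartanUp (L : Vec n × Vec n → ℝ) (r i j : Fin n) (p : Vec n × Vec n) : ℝ :=
  ∑ s, metricInv L p r s * cartan L s i j p

/-- The formal Christoffel symbols
`γ^i_jk = (1/2) g^ir (∂_j g_rk + ∂_k g_rj - ∂_r g_jk)`. -/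
def christoffel (L : Vec n × Vec n → ℝ) (i j k : Fin n) (p : Vec n × Vec n) : ℝ :=
  (1 / 2) * ∑ r, metricInv L p i r *
    (dx j (fun q => metric L q r k) p + dx k (fun q => metric L q r j) p
      - dx r (fun q => metric L q j k) p)

/-- The spray coefficients `G^i = (1/2) γ^i_jk y^j y^k`. -/
def spray (L : Vec n × Vec n → ℝ) (i : Fin n) (p : Vec n × Vec n) : ℝ :=
  (1 / 2) * ∑ j, ∑ k, christoffel L i j k p * p.2 j * p.2 k

/-- The nonlinear connection `N^i_j = ∂̇_j G^i` of the Cartan connection. -/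
def nonlin (L : Vec n × Vec n → ℝ) (i j : Fin n) (p : Vec n × Vec n) : ℝ :=
  dy j (spray L i) p

/-- The horizontal derivative `δ_k F = ∂_k F - N^r_k ∂̇_r F`. -/
def delta (L : Vec n × Vec n → ℝ) (k : Fin n) (F : Vec n × Vec n → ℝ) (p : Vec n × Vec n) : ℝ :=
  dx k F p - ∑ r, nonlin L r k p * dy r F p

/-- The horizontal coefficients of the Cartan connection,
`F^i_jk = (1/2) g^ir (δ_j g_rk + δ_k g_rj - δ_r g_jk)`. -/
def hConn (L : Vec n × Vec n → ℝ) (i j k : Fin n) (p : Vec n × Vec n) : ℝ :=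
  (1 / 2) * ∑ r, metricInv L p i r *
    (delta L j (fun q => metric L q r k) p + delta L k (fun q => metric L q r j) p
      - delta L r (fun q => metric L q j k) p)

/-- The `h`-covariant derivative `X_{i|j}` of a covariant vector field. -/
def hCov (L : Vec n × Vec n → ℝ) (X : Fin n → Vec n × Vec n → ℝ) (i j : Fin n)
    (p : Vec n × Vec n) : ℝ :=
  delta L j (X i) p - ∑ r, X r p * hConn L r i j p

/-- The `v`-covariant derivative `X_i|_j` of a covariant vector field. -/
def vCov (L : Vec n × Vec n → ℝ) (X : Fin n → Vec n × Vec n → ℝ) (i j : Fin n)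
    (p : Vec n × Vec n) : ℝ :=
  dy j (X i) p - ∑ r, X r p * cartanUp L r i j p

/-- The `h`-covariant derivative `C^r_{ij|k}`. -/
def cartanHCov (L : Vec n × Vec n → ℝ) (r i j k : Fin n) (p : Vec n × Vec n) : ℝ :=
  delta L k (cartanUp L r i j) p + ∑ s, cartanUp L s i j p * hConn L r s k p
    - ∑ s, cartanUp L r s j p * hConn L s i k p - ∑ s, cartanUp L r i s p * hConn L s j k p

/-- The `(v)hv`-torsion tensor `P^r_ij = C^r_{ij|0} = C^r_{ij|k} y^k`. -/
def torsionP (L : Vec n × Vec n → ℝ) (r i j : Fin n) (p : Vec n × Vec n) : ℝ :=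
  ∑ k, cartanHCov L r i j k p * p.2 k

/-- `L` is a Finsler fundamental function on the set `D` of line elements: `D` is open, contains
nonzero directions only and is invariant under positive scaling of the direction; `L` is smooth,
positive and positively homogeneous of degree one on `D`, with positive definite metric tensor. -/
structure IsFinslerOn (D : Set (Vec n × Vec n)) (L : Vec n × Vec n → ℝ) : Prop where
  isOpen : IsOpen D
  ne_zero : ∀ p ∈ D, p.2 ≠ 0
  cone : ∀ p ∈ D, ∀ t : ℝ, 0 < t → (p.1, t • p.2) ∈ D
  smooth : ContDiffOn ℝ ∞ L D
  pos : ∀ p ∈ D, 0 < L p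
  homog : ∀ p ∈ D, ∀ t : ℝ, 0 < t → L (p.1, t • p.2) = t * L p
  posDef : ∀ p ∈ D, (metric L p).PosDef

/-- `b_i(x, y)` is a (smooth) `h`-vector: `b_i|_k = 0` and `L C^h_ij b_h = ρ h_ij` for a scalar
function `ρ` on `D`. The case of a vanishing `ρ` is not excluded. -/
structure IsHVectorOn (D : Set (Vec n × Vec n)) (L : Vec n × Vec n → ℝ)
    (b : Fin n → Vec n × Vec n → ℝ) : Prop where
  smooth : ∀ i, ContDiffOn ℝ ∞ (b i) D
  vCov_eq_zero : ∀ p ∈ D, ∀ i k, vCov L b i k p = 0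
  exists_rho : ∃ ρ : Vec n × Vec n → ℝ, ∀ p ∈ D, ∀ i j,
    L p * ∑ h, cartanUp L h i j p * b h p = ρ p * angular L i j p

/-- A curve `t ↦ (x t, y t)` of line elements in `D`, `a < t < b`, is an `h`-path of a Finsler
connection with nonlinear part `N^i_j` and horizontal part `F^i_jk`:
`dy^i/dt + N^i_j dx^j/dt = 0` and `d²x^i/dt² + F^i_jk (dx^j/dt) (dx^k/dt) = 0`.
Here `w` is the velocity `dx/dt`. -/
def IsHPath (N : Fin n → Fin n → Vec n × Vec n → ℝ) (F : Fin n → Fin n → Fin n → Vec n × Vec n → ℝ)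
    (D : Set (Vec n × Vec n)) (a b : ℝ) (x y : ℝ → Vec n) : Prop :=
  ∃ w : ℝ → Vec n, ∀ t ∈ Set.Ioo a b, (x t, y t) ∈ D ∧ HasDerivAt x (w t) t ∧
    HasDerivAt y (fun i => -∑ j, N i j (x t, y t) * w t j) t ∧
    HasDerivAt w (fun i => -∑ j, ∑ k, F i j k (x t, y t) * w t j * w t k) t

end Coordinates

/-! ## Hypersurfaces in coordinates

`φ` is the parametric representation `x^i = x^i(u^α)`; a pair `(u, v)` is a line element of the
hypersurface. -/

section Hypersurface

variable {m n : ℕ}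

/-- The projection factors `B^i_α = ∂x^i/∂u^α`. -/
def proj (φ : Vec m → Vec n) (i : Fin n) (α : Fin m) (u : Vec m) : ℝ :=
  fderiv ℝ φ u (Pi.single α 1) i

/-- The second derivatives `B^i_αβ = ∂²x^i/∂u^α∂u^β`. -/
def proj2 (φ : Vec m → Vec n) (i : Fin n) (α β : Fin m) (u : Vec m) : ℝ :=
  fderiv ℝ (proj φ i α) u (Pi.single β 1)

/-- The line element `(x(u), y)`, `y^i = B^i_α(u) v^α`, of the ambient space. -/
def lift (φ : Vec m → Vec n) (q : Vec m × Vec m) : Vec n × Vec n :=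
  (φ q.1, fderiv ℝ φ q.1 q.2)

/-- The induced fundamental function `L(x(u), y(u, v))`. -/
def inducedL (L : Vec n × Vec n → ℝ) (φ : Vec m → Vec n) (q : Vec m × Vec m) : ℝ :=
  L (lift φ q)

/-- The inverse projection factors `B^α_i = g^αβ g_ij B^j_β`, with `g^αβ` the inverse metric tensor
of the induced Finsler function. -/
def projInv (L : Vec n × Vec n → ℝ) (φ : Vec m → Vec n) (α : Fin m) (i : Fin n)
    (q : Vec m × Vec m) : ℝ :=
  ∑ β, ∑ j, metricInv (inducedL L φ) q α β * metric L (lift φ q) i j * proj φ j β q.1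

/-- `K^i_β = B^i_{0β} + N^i_j B^j_β`, where `B^i_{0β} = B^i_{αβ} v^α`. -/
def dirDeriv (L : Vec n × Vec n → ℝ) (φ : Vec m → Vec n) (i : Fin n) (β : Fin m)
    (q : Vec m × Vec m) : ℝ :=
  ∑ α, proj2 φ i α β q.1 * q.2 α + ∑ j, nonlin L i j (lift φ q) * proj φ j β q.1

/-- The normal part `K^i_β - B^i_α B^α_j K^j_β` of `K^i_β`. For a unit normal vector `N^i` it equals
`N^i H_β`, where `H_β = N_j K^j_β` is the normal curvature vector. -/
def normalCurv (L : Vec n × Vec n → ℝ) (φ : Vec m → Vec n) (i : Fin n) (β : Fin m)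
    (q : Vec m × Vec m) : ℝ :=
  dirDeriv L φ i β q
    - ∑ α, ∑ j, proj φ i α q.1 * projInv L φ α j q * dirDeriv L φ j β q

/-- The nonlinear part `B^α_i (B^i_{0β} + N^i_j B^j_β)` of the induced Cartan connection. -/
def inducedNonlin (L : Vec n × Vec n → ℝ) (φ : Vec m → Vec n) (α β : Fin m)
    (q : Vec m × Vec m) : ℝ :=
  ∑ i, projInv L φ α i q * dirDeriv L φ i β q

/-- The horizontal part of the induced Cartan connection,
`F^α_βγ = B^α_i (B^i_βγ + F^i_jk B^j_β B^k_γ) + M^α_β H_γ`, where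
`M^α_β H_γ = B^α_i C^i_jk B^j_β N^k H_γ` with `N^k` the unit normal vector. -/
def inducedHConn (L : Vec n × Vec n → ℝ) (φ : Vec m → Vec n) (α β γ : Fin m)
    (q : Vec m × Vec m) : ℝ :=
  ∑ i, projInv L φ α i q *
    (proj2 φ i β γ q.1
      + ∑ j, ∑ k, hConn L i j k (lift φ q) * proj φ j β q.1 * proj φ k γ q.1
      + ∑ j, ∑ k, cartanUp L i j k (lift φ q) * proj φ j β q.1 * normalCurv L φ k γ q)

/-- The line elements of the hypersurface over `U` whose ambient line element lies in `D`. -/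
def liftDomain (φ : Vec m → Vec n) (U : Set (Vec m)) (D : Set (Vec n × Vec n)) :
    Set (Vec m × Vec m) :=
  {q | q.1 ∈ U ∧ lift φ q ∈ D}

/-- `X` is a unit normal vector `N^i` at the line element `q = (u, v)`:
`g_ij B^i_α N^j = 0` and `g_ij N^i N^j = 1`. -/
def IsUnitNormal (L : Vec n × Vec n → ℝ) (φ : Vec m → Vec n) (q : Vec m × Vec m) (X : Vec n) :
    Prop :=
  (∀ α, ∑ i, ∑ j, metric L (lift φ q) i j * proj φ i α q.1 * X j = 0) ∧
    ∑ i, ∑ j, metric L (lift φ q) i j * X i * X j = 1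

/-- The covector field `b_i` is tangential to the hypersurface: `b_i N^i = 0`. -/
def IsTangentialOn (L : Vec n × Vec n → ℝ) (b : Fin n → Vec n × Vec n → ℝ) (φ : Vec m → Vec n)
    (Q : Set (Vec m × Vec m)) : Prop :=
  ∀ q ∈ Q, ∀ X, IsUnitNormal L φ q X → ∑ i, b i (lift φ q) * X i = 0

/-- The second fundamental `v`-tensor `M_αβ = C_ijk B^i_α B^j_β N^k` vanishes. -/
def SecondVTensorVanishesOn (L : Vec n × Vec n → ℝ) (φ : Vec m → Vec n)
    (Q : Set (Vec m × Vec m)) : Prop :=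
  ∀ q ∈ Q, ∀ X, IsUnitNormal L φ q X → ∀ α β,
    ∑ i, ∑ j, ∑ k, cartan L i j k (lift φ q) * proj φ i α q.1 * proj φ j β q.1 * X k = 0

/-- Hyperplane of the second kind: each `h`-path of the hypersurface with respect to the induced
Cartan connection is an `h`-path of the ambient space with respect to the Cartan connection. -/
def IsSecondKindOn (D : Set (Vec n × Vec n)) (L : Vec n × Vec n → ℝ) (φ : Vec m → Vec n)
    (U : Set (Vec m)) : Prop :=
  ∀ (a b : ℝ) (u v : ℝ → Vec m),
    IsHPath (inducedNonlin L φ) (inducedHConn L φ) (liftDomain φ U D) a b u v →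
    IsHPath (nonlin L) (hConn L) D a b
      (fun t => (lift φ (u t, v t)).1) (fun t => (lift φ (u t, v t)).2)

/-- The covariant derivative, with respect to the Cartan connection, of a vector field `X t` along
a curve `(x t, y t)` of line elements:
`dX^i/dt + F^i_jk X^j dx^k/dt + C^i_jk X^j (dy^k/dt + N^k_r dx^r/dt)`. -/
def covDerivAlong (L : Vec n × Vec n → ℝ) (x y X : ℝ → Vec n) (t : ℝ) (i : Fin n) : ℝ :=
  deriv X t i + ∑ j, ∑ k, hConn L i j k (x t, y t) * X t j * deriv x t k
    + ∑ j, ∑ k, cartanUp L i j k (x t, y t) * X t j *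
        (deriv y t k + ∑ r, nonlin L k r (x t, y t) * deriv x t r)

/-- Hyperplane of the third kind: the unit normal vector is parallel along each curve of line
elements of the hypersurface. -/
def IsThirdKindOn (D : Set (Vec n × Vec n)) (L : Vec n × Vec n → ℝ) (φ : Vec m → Vec n)
    (U : Set (Vec m)) : Prop :=
  ∀ (a b : ℝ) (u v : ℝ → Vec m) (X : ℝ → Vec n),
    ContDiffOn ℝ ∞ u (Set.Ioo a b) → ContDiffOn ℝ ∞ v (Set.Ioo a b) →
    ContDiffOn ℝ ∞ X (Set.Ioo a b) →
    (∀ t ∈ Set.Ioo a b, (u t, v t) ∈ liftDomain φ U D ∧ IsUnitNormal L φ (u t, v t) (X t)) →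
    ∀ t ∈ Set.Ioo a b, ∀ i,
      covDerivAlong L (fun s => (lift φ (u s, v s)).1) (fun s => (lift φ (u s, v s)).2) X t i = 0

end Hypersurface

/-! ## Finsler manifolds

The fundamental function `L` and the covector field `b` live on a set `D` of tangent vectors of a
smooth manifold `M`; the notions above are required in every chart of the smooth structure. -/

section Manifold

variable {m n : ℕ}
  {M : Type*} [TopologicalSpace M] [ChartedSpace (Vec n) M]
  {S : Type*} [TopologicalSpace S] [ChartedSpace (Vec m) S]

/-- The tangent vector with coordinates `(x, y)` in the chart `e`. -/
def tangentOf (e : OpenPartialHomeomorph M (Vec n)) (p : Vec n × Vec n) :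
    TangentBundle 𝓘(ℝ, Vec n) M :=
  ⟨e.symm p.1, mfderiv 𝓘(ℝ, Vec n) 𝓘(ℝ, Vec n) e.symm p.1 p.2⟩

/-- `D` in the chart `e`. -/
def localDomain (e : OpenPartialHomeomorph M (Vec n)) (D : Set (TangentBundle 𝓘(ℝ, Vec n) M)) :
    Set (Vec n × Vec n) :=
  {p | p.1 ∈ e.target ∧ tangentOf e p ∈ D}

/-- The coordinate expression of a function of tangent vectors. -/
def localFun (e : OpenPartialHomeomorph M (Vec n)) (L : TangentBundle 𝓘(ℝ, Vec n) M → ℝ)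
    (p : Vec n × Vec n) : ℝ :=
  L (tangentOf e p)

/-- The components `b_i(x, y)` of a direction dependent covector field: the values of `b(x, y)` on
the coordinate vectors of the chart. -/
def localCovector (e : OpenPartialHomeomorph M (Vec n))
    (b : (p : TangentBundle 𝓘(ℝ, Vec n) M) → TangentSpace 𝓘(ℝ, Vec n) p.proj →L[ℝ] ℝ)
    (i : Fin n) (p : Vec n × Vec n) : ℝ :=
  b (tangentOf e p) (tangentOf e (p.1, Pi.single i 1)).snd

/-- The coordinate expression of a map in the charts `c` of `S` and `e` of `M`. -/
def localMap (c : OpenPartialHomeomorph S (Vec m)) (e : OpenPartialHomeomorph M (Vec n))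
    (f : S → M) (u : Vec m) : Vec n :=
  e (f (c.symm u))

/-- The domain of the coordinate expression of a map. -/
def localMapDomain (c : OpenPartialHomeomorph S (Vec m)) (e : OpenPartialHomeomorph M (Vec n))
    (f : S → M) : Set (Vec m) :=
  {u | u ∈ c.target ∧ f (c.symm u) ∈ e.source}

/-- The charts of the smooth structure. -/
abbrev smoothCharts (n : ℕ) (M : Type*) [TopologicalSpace M] [ChartedSpace (Vec n) M] :
    Set (OpenPartialHomeomorph M (Vec n)) :=
  IsManifold.maximalAtlas 𝓘(ℝ, Vec n) ∞ M

/-- `(M, L)` is a Finsler space, with `L` defined on the set `D` of tangent vectors. -/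
def IsFinsler (D : Set (TangentBundle 𝓘(ℝ, Vec n) M)) (L : TangentBundle 𝓘(ℝ, Vec n) M → ℝ) :
    Prop :=
  ∀ e ∈ smoothCharts n M, IsFinslerOn (localDomain e D) (localFun e L)

/-- `(M, L)` is a Landsberg space: `P^r_ij = C^r_{ij|0} = 0`. -/
def IsLandsberg (D : Set (TangentBundle 𝓘(ℝ, Vec n) M)) (L : TangentBundle 𝓘(ℝ, Vec n) M → ℝ) :
    Prop :=
  ∀ e ∈ smoothCharts n M, ∀ p ∈ localDomain e D, ∀ r i j, torsionP (localFun e L) r i j p = 0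

/-- `b` is an `h`-vector of `(M, L)`. -/
def IsHVector (D : Set (TangentBundle 𝓘(ℝ, Vec n) M)) (L : TangentBundle 𝓘(ℝ, Vec n) M → ℝ)
    (b : (p : TangentBundle 𝓘(ℝ, Vec n) M) → TangentSpace 𝓘(ℝ, Vec n) p.proj →L[ℝ] ℝ) : Prop :=
  ∀ e ∈ smoothCharts n M, IsHVectorOn (localDomain e D) (localFun e L) (localCovector e b)

/-- `b` is a gradient: `b_{i|j} = b_{j|i}`. -/
def IsGradient (D : Set (TangentBundle 𝓘(ℝ, Vec n) M)) (L : TangentBundle 𝓘(ℝ, Vec n) M → ℝ)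
    (b : (p : TangentBundle 𝓘(ℝ, Vec n) M) → TangentSpace 𝓘(ℝ, Vec n) p.proj →L[ℝ] ℝ) : Prop :=
  ∀ e ∈ smoothCharts n M, ∀ p ∈ localDomain e D, ∀ i j,
    hCov (localFun e L) (localCovector e b) i j p = hCov (localFun e L) (localCovector e b) j i p

/-- The `h`-exponential change `*L = L e^{β/L}`, `β = b_i(x, y) y^i`. -/
def hExpChange (L : TangentBundle 𝓘(ℝ, Vec n) M → ℝ)
    (b : (p : TangentBundle 𝓘(ℝ, Vec n) M) → TangentSpace 𝓘(ℝ, Vec n) p.proj →L[ℝ] ℝ)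
    (p : TangentBundle 𝓘(ℝ, Vec n) M) : ℝ :=
  L p * Real.exp (b p p.snd / L p)

/-- `f : S → M` represents a hypersurface: it is a smooth immersion and `dim M = dim S + 1`. -/
structure IsHypersurface {M : Type*} [TopologicalSpace M] [ChartedSpace (Vec (m + 1)) M]
    (f : S → M) : Prop where
  smooth : ContMDiff 𝓘(ℝ, Vec m) 𝓘(ℝ, Vec (m + 1)) ∞ f
  immersion : ∀ s, Function.Injective (mfderiv 𝓘(ℝ, Vec m) 𝓘(ℝ, Vec (m + 1)) f s)

/-- The covector field `b` is tangential to the hypersurface `f` of `(M, L)`. -/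
def IsTangential (D : Set (TangentBundle 𝓘(ℝ, Vec n) M)) (L : TangentBundle 𝓘(ℝ, Vec n) M → ℝ)
    (b : (p : TangentBundle 𝓘(ℝ, Vec n) M) → TangentSpace 𝓘(ℝ, Vec n) p.proj →L[ℝ] ℝ)
    (f : S → M) : Prop :=
  ∀ c ∈ smoothCharts m S, ∀ e ∈ smoothCharts n M,
    IsTangentialOn (localFun e L) (localCovector e b) (localMap c e f)
      (liftDomain (localMap c e f) (localMapDomain c e f) (localDomain e D))

/-- `M_αβ = 0` for the hypersurface `f` of `(M, L)`. -/
def SecondVTensorVanishes (D : Set (TangentBundle 𝓘(ℝ, Vec n) M))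
    (L : TangentBundle 𝓘(ℝ, Vec n) M → ℝ) (f : S → M) : Prop :=
  ∀ c ∈ smoothCharts m S, ∀ e ∈ smoothCharts n M,
    SecondVTensorVanishesOn (localFun e L) (localMap c e f)
      (liftDomain (localMap c e f) (localMapDomain c e f) (localDomain e D))

/-- The hypersurface `f` of `(M, L)` is a hyperplane of the second kind. -/
def IsHyperplaneSecondKind (D : Set (TangentBundle 𝓘(ℝ, Vec n) M))
    (L : TangentBundle 𝓘(ℝ, Vec n) M → ℝ) (f : S → M) : Prop :=
  ∀ c ∈ smoothCharts m S, ∀ e ∈ smoothCharts n M,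
    IsSecondKindOn (localDomain e D) (localFun e L) (localMap c e f) (localMapDomain c e f)

/-- The hypersurface `f` of `(M, L)` is a hyperplane of the third kind. -/
def IsHyperplaneThirdKind (D : Set (TangentBundle 𝓘(ℝ, Vec n) M))
    (L : TangentBundle 𝓘(ℝ, Vec n) M → ℝ) (f : S → M) : Prop :=
  ∀ c ∈ smoothCharts m S, ∀ e ∈ smoothCharts n M,
    IsThirdKindOn (localDomain e D) (localFun e L) (localMap c e f) (localMapDomain c e f)

end Manifold

end HExpFinsler

end

open HExpFinsler

/-! Everything is expressed through the energy `E = L²/2`. On vertical vectors `D²E` is the metric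
and `D³E` is twice the Cartan tensor; the spray is determined by the Euler-Lagrange equation
`euler_lagrange`. The connection identities follow by differentiating a known identity along a curve
and testing vectors against the nondegenerate metric.

The property that is carried from `L` to `L e^{β/L}` is flatness (`IsFlatOn`): `H_β = 0` and `M_αβ =
0`. A hypersurface of the third kind is the same as a flat one. One of the second kind has `H_β =
0`, hence is flat once `M_αβ = 0`; and flat ones are of the second kind. Recovering either kind from
flatness needs the second fundamental `h`-tensor to vanish as well (`second_fundamental_tangent`).
Differentiating `H_β = 0` in `v` gives this for the Berwald coefficients, which differ from the
Cartan ones by the derivative of the Cartan tensor along the spray (`berwald_eq`). On a flat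
submanifold the spray is tangent to the lifted line elements, so `M_αβ = 0` can be differentiated
along it, and the relevant component of that difference vanishes (`nabla_cartan_eq_zero`).

For the change, `dE' = P dE + R dβ` with scalar functions `P`, `R`. Both `dE` and `dβ` vanish on
normal vectors, the latter because `b` is tangential. The `h`-vector condition makes the vertical
Hessian of `β` a multiple of the angular metric, so the normal directions agree for `L` and `L'`,
and `M_αβ = 0` persists. Since `b` is a gradient, `β` satisfies the Euler-Lagrange equation along
the spray of `L` (`euler_lagrange_betaFun`). Hence the difference of the two sprays is dual to a
combination of `dE` and `dβ` (`d2_spray_sub`), so it is tangential. Its vertical derivative shows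
that the difference of the nonlinear connections maps tangential vectors to tangential ones, and
`H_β = 0` persists (`IsFlatOn.change`). -/

noncomputable section

namespace HExpFinsler

/-! ## Iterated derivatives as multilinear maps -/

section Calculus

variable {P : Type*} [NormedAddCommGroup P] [NormedSpace ℝ P]

set_option maxSynthPendingDepth 3

/-- The second derivative. -/
def d2 (F : P → ℝ) (p : P) : P →L[ℝ] P →L[ℝ] ℝ := fderiv ℝ (fderiv ℝ F) p

/-- The third derivative. -/
def d3 (F : P → ℝ) (p : P) : P →L[ℝ] P →L[ℝ] P →L[ℝ] ℝ := fderiv ℝ (d2 F) p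

/-- The fourth derivative. -/
def d4 (F : P → ℝ) (p : P) : P →L[ℝ] P →L[ℝ] P →L[ℝ] P →L[ℝ] ℝ := fderiv ℝ (d3 F) p

section

variable {W : Type*} [NormedAddCommGroup W] [NormedSpace ℝ W] {D : Set P} (hD : IsOpen D)

include hD

theorem contDiffOn_fderiv {F : P → W} (hF : ContDiffOn ℝ ∞ F D) :
    ContDiffOn ℝ ∞ (fderiv ℝ F) D :=
  hF.fderiv_of_isOpen hD (by simp)

theorem hasFDerivAt_of_contDiffOn {F : P → W} (hF : ContDiffOn ℝ ∞ F D) {p : P} (hp : p ∈ D) :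
    HasFDerivAt F (fderiv ℝ F p) p :=
  ((hF.contDiffAt (hD.mem_nhds hp)).differentiableAt (by simp)).hasFDerivAt

theorem hasDerivAt_comp_of_contDiffOn {F : P → W} (hF : ContDiffOn ℝ ∞ F D) {γ : ℝ → P} {γ' : P}
    {t : ℝ} (hp : γ t ∈ D) (hγ : HasDerivAt γ γ' t) :
    HasDerivAt (fun s => F (γ s)) (fderiv ℝ F (γ t) γ') t :=
  (hasFDerivAt_of_contDiffOn hD hF hp).comp_hasDerivAt t hγ

theorem fderiv_fderiv_comm {F : P → W} (hF : ContDiffOn ℝ ∞ F D) {p : P} (hp : p ∈ D) (a b : P) :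
    fderiv ℝ (fderiv ℝ F) p a b = fderiv ℝ (fderiv ℝ F) p b a :=
  (hF.contDiffAt (hD.mem_nhds hp)).isSymmSndFDerivAt (by simpa using ENat.LEInfty.out) a b

omit [NormedSpace ℝ P] in
/-- Functions that agree along a curve inside an open set have the same derivative. -/
theorem deriv_eq_of_eqOn {γ : ℝ → P} {t : ℝ} (hγ : ContinuousAt γ t) (hp : γ t ∈ D)
    {f g : ℝ → W} (h : ∀ s, γ s ∈ D → f s = g s) {f' g' : W}
    (hf : HasDerivAt f f' t) (hg : HasDerivAt g g' t) : f' = g' := by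
  have h1 : f =ᶠ[nhds t] g := by
    filter_upwards [hγ.preimage_mem_nhds (hD.mem_nhds hp)] with s hs using h s hs
  exact hf.unique (hg.congr_of_eventuallyEq h1)

variable {F : P → ℝ} (hF : ContDiffOn ℝ ∞ F D)

include hF

theorem contDiffOn_d2 : ContDiffOn ℝ ∞ (d2 F) D := contDiffOn_fderiv hD (contDiffOn_fderiv hD hF)

theorem contDiffOn_d3 : ContDiffOn ℝ ∞ (d3 F) D := contDiffOn_fderiv hD (contDiffOn_d2 hD hF)

variable {p : P} (hp : p ∈ D)

theorem hasDerivAt_d1_apply {γ A : ℝ → P} {γ' A' : P} {t : ℝ} (hp : γ t ∈ D)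
    (hγ : HasDerivAt γ γ' t) (hA : HasDerivAt A A' t) :
    HasDerivAt (fun s => fderiv ℝ F (γ s) (A s))
      (d2 F (γ t) γ' (A t) + fderiv ℝ F (γ t) A') t :=
  (hasDerivAt_comp_of_contDiffOn hD (contDiffOn_fderiv hD hF) hp hγ).clm_apply hA

theorem hasDerivAt_d2_apply {γ A B : ℝ → P} {γ' A' B' : P} {t : ℝ} (hp : γ t ∈ D)
    (hγ : HasDerivAt γ γ' t) (hA : HasDerivAt A A' t) (hB : HasDerivAt B B' t) :
    HasDerivAt (fun s => d2 F (γ s) (A s) (B s))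
      (d3 F (γ t) γ' (A t) (B t) + d2 F (γ t) A' (B t) + d2 F (γ t) (A t) B') t := by
  have := (((hasDerivAt_comp_of_contDiffOn hD (contDiffOn_d2 hD hF) hp hγ).clm_apply hA).clm_apply
    hB)
  simpa only [add_apply, d3] using this

theorem hasDerivAt_d3_apply {γ A B C : ℝ → P} {γ' A' B' C' : P} {t : ℝ} (hp : γ t ∈ D)
    (hγ : HasDerivAt γ γ' t) (hA : HasDerivAt A A' t) (hB : HasDerivAt B B' t)
    (hC : HasDerivAt C C' t) :
    HasDerivAt (fun s => d3 F (γ s) (A s) (B s) (C s))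
      (d4 F (γ t) γ' (A t) (B t) (C t) + d3 F (γ t) A' (B t) (C t) + d3 F (γ t) (A t) B' (C t)
        + d3 F (γ t) (A t) (B t) C') t := by
  have := (((hasDerivAt_comp_of_contDiffOn hD (contDiffOn_d3 hD hF) hp hγ).clm_apply
    hA).clm_apply hB).clm_apply hC
  simpa only [add_apply, d4] using this

include hp

theorem d2_comm (a b : P) : d2 F p a b = d2 F p b a := fderiv_fderiv_comm hD hF hp a b

theorem d3_comm_left (a b c : P) : d3 F p a b c = d3 F p b a c := by
  have := fderiv_fderiv_comm hD (contDiffOn_fderiv hD hF) hp a b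
  exact congrArg (fun T : P →L[ℝ] ℝ => T c) this

omit hD hF hp in
theorem hasDerivAt_line (p w : P) : HasDerivAt (fun s : ℝ => p + s • w) w 0 := by
  simpa using ((hasDerivAt_id (0 : ℝ)).smul_const w).const_add p

/-- Symmetry of the second derivative holds throughout the open set, so it may be differentiated in
the direction `a`. -/
theorem d3_comm_right (a b c : P) : d3 F p a b c = d3 F p a c b := by
  have hl := hasDerivAt_line p a
  have hp0 : p + (0 : ℝ) • a ∈ D := by simpa using hp
  have h1 := hasDerivAt_d2_apply hD hF hp0 hl (hasDerivAt_const 0 b) (hasDerivAt_const 0 c)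
  have h2 := hasDerivAt_d2_apply hD hF hp0 hl (hasDerivAt_const 0 c) (hasDerivAt_const 0 b)
  have := deriv_eq_of_eqOn hD hl.continuousAt hp0 (fun s hs => d2_comm hD hF hs b c) h1 h2
  simpa using this

theorem d4_comm_left (a b c d : P) : d4 F p a b c d = d4 F p b a c d := by
  have : d4 F p a b = d4 F p b a := fderiv_fderiv_comm hD (contDiffOn_d2 hD hF) hp a b
  rw [this]

end

end Calculus

/-! ## Smoothness of the inverse of a matrix -/

theorem contDiffOn_det {P ι : Type*} [NormedAddCommGroup P] [NormedSpace ℝ P] [Fintype ι]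
    [DecidableEq ι] {D : Set P} {A : P → Matrix ι ι ℝ}
    (hA : ∀ i j, ContDiffOn ℝ ∞ (fun p => A p i j) D) : ContDiffOn ℝ ∞ (fun p => (A p).det) D := by
  simp only [Matrix.det_apply']
  exact ContDiffOn.sum fun σ _ => contDiffOn_const.mul (contDiffOn_prod fun i _ => hA _ _)

/-- Cramer's rule: the entries are quotients of determinants with nonvanishing denominator. -/
theorem contDiffOn_matrix_inv {P ι : Type*} [NormedAddCommGroup P] [NormedSpace ℝ P] [Fintype ι]
    [DecidableEq ι] {D : Set P} {A : P → Matrix ι ι ℝ}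
    (hA : ∀ i j, ContDiffOn ℝ ∞ (fun p => A p i j) D) (hdet : ∀ p ∈ D, (A p).det ≠ 0) (i j : ι) :
    ContDiffOn ℝ ∞ (fun p => (A p)⁻¹ i j) D := by
  simp only [Matrix.inv_def, Ring.inverse_eq_inv', Matrix.smul_apply, smul_eq_mul,
    Matrix.adjugate_apply]
  refine ((contDiffOn_det hA).inv hdet).mul (contDiffOn_det fun k l => ?_)
  by_cases h : k = j
  · subst h; simpa using contDiffOn_const
  · simpa [Matrix.updateRow_ne h] using hA k l


/-! ## The tensors of a Finsler function as derivatives of its energy -/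

section Energy

variable {n : ℕ}

/-- The vertical vector `(0, Y)`. -/
def vert : Vec n →L[ℝ] Vec n × Vec n := ContinuousLinearMap.inr ℝ (Vec n) (Vec n)

/-- The vector `(X, 0)` of a coordinate system. -/
def hor : Vec n →L[ℝ] Vec n × Vec n := ContinuousLinearMap.inl ℝ (Vec n) (Vec n)

theorem vert_apply (Y : Vec n) : vert Y = (0, Y) := rfl

theorem hor_apply (X : Vec n) : hor X = (X, 0) := rfl

theorem mk_eq_hor_add_vert (X Y : Vec n) : ((X, Y) : Vec n × Vec n) = hor X + vert Y := by
  simp [vert_apply, hor_apply]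

theorem vec_eq_sum (X : Vec n) : X = ∑ i, X i • (Pi.single i 1 : Vec n) := by
  ext j; simp [Finset.sum_apply, Pi.single_apply]

theorem vert_eq_sum (X : Vec n) : vert X = ∑ i, X i • vert (Pi.single i 1 : Vec n) := by
  conv_lhs => rw [vec_eq_sum X]
  simp only [map_sum, map_smul]

theorem hor_eq_sum (X : Vec n) : hor X = ∑ i, X i • hor (Pi.single i 1 : Vec n) := by
  conv_lhs => rw [vec_eq_sum X]
  simp only [map_sum, map_smul]

/-- The energy `L² / 2`. -/
def energy (L : Vec n × Vec n → ℝ) (p : Vec n × Vec n) : ℝ := (1 / 2) * L p ^ 2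

/-- The spray coefficients as a vector. -/
def sprayVec (L : Vec n × Vec n → ℝ) (p : Vec n × Vec n) : Vec n := fun i => spray L i p

/-- The spray `y^k ∂_k - 2 G^k ∂̇_k`. -/
def sprayField (L : Vec n × Vec n → ℝ) (p : Vec n × Vec n) : Vec n × Vec n :=
  hor p.2 - (2 : ℝ) • vert (sprayVec L p)

/-- The nonlinear connection as a linear map. -/
def nonlinMap (L : Vec n × Vec n → ℝ) (p : Vec n × Vec n) : Vec n →L[ℝ] Vec n :=
  (fderiv ℝ (sprayVec L) p).comp vert

/-- The horizontal lift of a vector. -/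
def hlift (L : Vec n × Vec n → ℝ) (p : Vec n × Vec n) : Vec n →L[ℝ] Vec n × Vec n :=
  hor - vert.comp (nonlinMap L p)

theorem hlift_apply (L : Vec n × Vec n → ℝ) (p : Vec n × Vec n) (X : Vec n) :
    hlift L p X = hor X - vert (nonlinMap L p X) := rfl

/-- The vector `F^i_jk X^j Y^k`. -/
def hConnVec (L : Vec n × Vec n → ℝ) (p : Vec n × Vec n) (X Y : Vec n) : Vec n :=
  fun i => ∑ j, ∑ k, hConn L i j k p * X j * Y k

/-- The vector `C^i_jk X^j Y^k`. -/
def cartanVec (L : Vec n × Vec n → ℝ) (p : Vec n × Vec n) (X Y : Vec n) : Vec n :=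
  fun i => ∑ j, ∑ k, cartanUp L i j k p * X j * Y k

theorem dy_sq {D : Set (Vec n × Vec n)} {L : Vec n × Vec n → ℝ} (hD : IsOpen D)
    (hE : ContDiffOn ℝ ∞ (energy L) D) {p : Vec n × Vec n} (hp : p ∈ D) (j : Fin n) :
    dy j (fun q => L q ^ 2) p = 2 * fderiv ℝ (energy L) p (vert (Pi.single j 1)) := by
  have h := hasFDerivAt_of_contDiffOn hD hE hp
  have h2 : HasFDerivAt (fun q => L q ^ 2) ((2 : ℝ) • fderiv ℝ (energy L) p) p := by
    refine (h.const_mul 2).congr_of_eventuallyEq (Filter.Eventually.of_forall fun q => ?_)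
    simp only [energy]; ring
  simp [dy, h2.fderiv, vert_apply]

/-- Only smoothness of the energy enters, so the formula also serves the induced function before its
metric is known to be positive definite. -/
theorem metric_eq_d2 {D : Set (Vec n × Vec n)} {L : Vec n × Vec n → ℝ} (hD : IsOpen D)
    (hE : ContDiffOn ℝ ∞ (energy L) D) {p : Vec n × Vec n} (hp : p ∈ D) (i j : Fin n) :
    metric L p i j = d2 (energy L) p (vert (Pi.single i 1)) (vert (Pi.single j 1)) := by
  have h := hasFDerivAt_of_contDiffOn hD
    (contDiffOn_fderiv hD hE) hp
  have h2 : HasFDerivAt (dy j fun q => L q ^ 2)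
      ((2 : ℝ) • (fderiv ℝ (fderiv ℝ (energy L)) p).flip (vert (Pi.single j 1))) p := by
    refine ((h.clm_apply (hasFDerivAt_const (vert (Pi.single j 1 : Vec n)) p)).const_mul
      2).congr_of_eventuallyEq ?_ |>.congr_fderiv ?_
    · filter_upwards [hD.mem_nhds hp] with q hq using dy_sq hD hE hq j
    · ext <;> simp
  simp only [metric, Matrix.of_apply]
  rw [dy, h2.fderiv]
  simp [d2, vert_apply]

namespace IsFinslerOn

variable {D : Set (Vec n × Vec n)} {L : Vec n × Vec n → ℝ} (hL : IsFinslerOn D L)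

include hL

theorem contDiffOn_energy : ContDiffOn ℝ ∞ (energy L) D :=
  contDiffOn_const.mul (hL.smooth.pow 2)

variable {p : Vec n × Vec n} (hp : p ∈ D)

include hp

theorem energy_pos : 0 < energy L p := by
  have := hL.pos p hp
  unfold energy; positivity

theorem metric_eq (i j : Fin n) :
    metric L p i j = d2 (energy L) p (vert (Pi.single i 1)) (vert (Pi.single j 1)) :=
  metric_eq_d2 hL.isOpen hL.contDiffOn_energy hp i j

theorem hasFDerivAt_metric (i j : Fin n) :
    HasFDerivAt (fun q => metric L q i j)
      (((d3 (energy L) p).flip (vert (Pi.single i 1))).flip (vert (Pi.single j 1))) p := by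
  have h := hasFDerivAt_of_contDiffOn hL.isOpen (contDiffOn_d2 hL.isOpen hL.contDiffOn_energy) hp
  refine ((h.clm_apply (hasFDerivAt_const (vert (Pi.single i 1 : Vec n)) p)).clm_apply
    (hasFDerivAt_const (vert (Pi.single j 1 : Vec n)) p)).congr_of_eventuallyEq ?_
      |>.congr_fderiv ?_
  · filter_upwards [hL.isOpen.mem_nhds hp] with q hq using hL.metric_eq hq i j
  · ext <;> simp [d3]

theorem fderiv_metric (i j : Fin n) (w : Vec n × Vec n) :
    fderiv ℝ (fun q => metric L q i j) p w =
      d3 (energy L) p w (vert (Pi.single i 1)) (vert (Pi.single j 1)) := by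
  rw [(hL.hasFDerivAt_metric hp i j).fderiv]; rfl

theorem cartan_eq (i j k : Fin n) :
    cartan L i j k p = (1 / 2) * d3 (energy L) p (vert (Pi.single i 1)) (vert (Pi.single j 1))
      (vert (Pi.single k 1)) := by
  rw [cartan, dy, hL.fderiv_metric hp]; rfl

theorem d2_vert_eq_sum (X Y : Vec n) :
    d2 (energy L) p (vert X) (vert Y) = ∑ i, ∑ j, metric L p i j * X i * Y j := by
  simp only [hL.metric_eq hp]
  rw [vert_eq_sum X]
  simp only [map_sum, map_smul, sum_apply, smul_apply, smul_eq_mul]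
  refine Finset.sum_congr rfl fun i _ => ?_
  rw [vert_eq_sum Y]
  simp only [map_sum, map_smul, smul_eq_mul, Finset.mul_sum]
  exact Finset.sum_congr rfl fun j _ => by ring

theorem d3_vert_eq_sum (X Y Z : Vec n) :
    d3 (energy L) p (vert X) (vert Y) (vert Z) =
      2 * ∑ i, ∑ j, ∑ k, cartan L i j k p * X i * Y j * Z k := by
  simp only [hL.cartan_eq hp]
  rw [vert_eq_sum X]
  simp only [map_sum, map_smul, sum_apply, smul_apply, smul_eq_mul, Finset.mul_sum]
  refine Finset.sum_congr rfl fun i _ => ?_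
  rw [vert_eq_sum Y]
  simp only [map_sum, map_smul, sum_apply, smul_apply, smul_eq_mul, Finset.mul_sum]
  refine Finset.sum_congr rfl fun j _ => ?_
  rw [vert_eq_sum Z]
  simp only [map_sum, map_smul, smul_eq_mul, Finset.mul_sum]
  exact Finset.sum_congr rfl fun k _ => by ring

theorem d2_vert_pos {X : Vec n} (hX : X ≠ 0) : 0 < d2 (energy L) p (vert X) (vert X) := by
  have := (hL.posDef p hp).dotProduct_mulVec_pos hX
  rw [hL.d2_vert_eq_sum hp]
  simp only [dotProduct, Matrix.mulVec, star_trivial, Finset.mul_sum] at this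
  exact this.trans_eq (Finset.sum_congr rfl fun i _ => Finset.sum_congr rfl fun j _ => by ring)

theorem eq_zero_of_d2_vert_self {X : Vec n} (h : d2 (energy L) p (vert X) (vert X) = 0) :
    X = 0 := by
  by_contra hX
  exact (hL.d2_vert_pos hp hX).ne' h

/-- Definiteness of the metric; this is how identities between connection vectors are tested below.
-/
theorem eq_of_d2_vert {X Y : Vec n}
    (h : ∀ Z, d2 (energy L) p (vert X) (vert Z) = d2 (energy L) p (vert Y) (vert Z)) : X = Y := by
  rw [← sub_eq_zero]
  refine hL.eq_zero_of_d2_vert_self hp ?_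
  have h' := h (X - Y)
  simp only [map_sub, sub_apply] at h' ⊢
  linarith

theorem metric_mulVec_metricInv (c : Vec n) (i : Fin n) :
    ∑ j, metric L p i j * ∑ k, metricInv L p j k * c k = c i := by
  have hdet : IsUnit (metric L p).det := (Matrix.isUnit_iff_isUnit_det _).1 (hL.posDef p hp).isUnit
  have : Matrix.mulVec (metric L p) (Matrix.mulVec (metric L p)⁻¹ c) = c := by
    rw [Matrix.mulVec_mulVec, Matrix.mul_nonsing_inv _ hdet, Matrix.one_mulVec]
  exact congrFun this i

/-- Raising an index with the inverse metric. -/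
theorem d2_vert_of_eq_metricInv {W c : Vec n} (hW : ∀ i, W i = ∑ r, metricInv L p i r * c r)
    (Z : Vec n) : d2 (energy L) p (vert W) (vert Z) = ∑ r, c r * Z r := by
  rw [d2_comm hL.isOpen hL.contDiffOn_energy hp, hL.d2_vert_eq_sum hp]
  refine Finset.sum_congr rfl fun i _ => ?_
  rw [← hL.metric_mulVec_metricInv hp c i, Finset.sum_mul]
  refine Finset.sum_congr rfl fun j _ => ?_
  rw [hW]; ring

/-! ### Homogeneity -/

/-- Euler's relation in degree two: differentiate `E(x, ty) = t² E(x, y)` at `t = 1`. -/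
theorem fderiv_energy_vert_self : fderiv ℝ (energy L) p (vert p.2) = 2 * energy L p := by
  have hγ : HasDerivAt (fun t : ℝ => ((p.1, t • p.2) : Vec n × Vec n)) (vert p.2) 1 := by
    have := (hasDerivAt_const (1 : ℝ) p.1).prodMk ((hasDerivAt_id (1 : ℝ)).smul_const p.2)
    simpa [vert_apply] using this
  have hp1 : ((p.1, (1 : ℝ) • p.2) : Vec n × Vec n) ∈ D := by simpa using hp
  have h1 := hasDerivAt_comp_of_contDiffOn hL.isOpen hL.contDiffOn_energy hp1 hγ
  have h2 : HasDerivAt (fun t : ℝ => t ^ 2 * energy L p) (2 * energy L p) 1 := by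
    simpa using (hasDerivAt_pow 2 (1 : ℝ)).mul_const (energy L p)
  have h3 : (fun t : ℝ => energy L (p.1, t • p.2)) =ᶠ[nhds 1] fun t => t ^ 2 * energy L p := by
    filter_upwards [lt_mem_nhds (zero_lt_one' ℝ)] with t ht
    simp only [energy, hL.homog p hp t ht]; ring
  simpa using h1.unique (h2.congr_of_eventuallyEq h3)

/-- Differentiate Euler's relation along `p + s w`. The supporting element moves as well, which
produces the term with `w.2`. -/
theorem d2_vert_self (w : Vec n × Vec n) :
    d2 (energy L) p w (vert p.2) = 2 * fderiv ℝ (energy L) p w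
      - fderiv ℝ (energy L) p (vert w.2) := by
  have hl := hasDerivAt_line p w
  have hp0 : p + (0 : ℝ) • w ∈ D := by simpa using hp
  have hl2 : HasDerivAt (fun s : ℝ => vert (p + s • w).2) (vert w.2) 0 :=
    vert.hasFDerivAt.comp_hasDerivAt (0 : ℝ) hl.snd
  have h1 := hasDerivAt_d1_apply hL.isOpen hL.contDiffOn_energy hp0 hl hl2
  have h2 := (hasDerivAt_comp_of_contDiffOn hL.isOpen hL.contDiffOn_energy hp0 hl).const_mul 2
  have := deriv_eq_of_eqOn hL.isOpen hl.continuousAt hp0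
    (fun s hs => hL.fderiv_energy_vert_self hs) h1 h2
  simp only [zero_smul, add_zero] at this
  linarith

/-- One more derivative of the previous relation. Its specializations include `C_ij0 = 0`. -/
theorem d3_vert_self (v w : Vec n × Vec n) :
    d3 (energy L) p v w (vert p.2) = 2 * d2 (energy L) p v w
      - d2 (energy L) p v (vert w.2) - d2 (energy L) p w (vert v.2) := by
  have hl := hasDerivAt_line p v
  have hp0 : p + (0 : ℝ) • v ∈ D := by simpa using hp
  have hl2 : HasDerivAt (fun s : ℝ => vert (p + s • v).2) (vert v.2) 0 :=
    vert.hasFDerivAt.comp_hasDerivAt (0 : ℝ) hl.snd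
  have h1 := hasDerivAt_d2_apply hL.isOpen hL.contDiffOn_energy hp0 hl (hasDerivAt_const 0 w) hl2
  have h2 := ((hasDerivAt_d1_apply hL.isOpen hL.contDiffOn_energy hp0 hl
    (hasDerivAt_const 0 w)).const_mul 2).sub
    (hasDerivAt_d1_apply hL.isOpen hL.contDiffOn_energy hp0 hl (hasDerivAt_const 0 (vert w.2)))
  have := deriv_eq_of_eqOn hL.isOpen hl.continuousAt hp0 (fun s hs => hL.d2_vert_self hs w) h1 h2
  simp only [zero_smul, add_zero, map_zero, zero_apply] at this
  linarith

theorem d2_vert_vert_self (Z : Vec n) :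
    d2 (energy L) p (vert Z) (vert p.2) = fderiv ℝ (energy L) p (vert Z) := by
  rw [hL.d2_vert_self hp]; simp only [vert_apply]; ring

theorem d2_hor_vert_self (Z : Vec n) :
    d2 (energy L) p (hor Z) (vert p.2) = 2 * fderiv ℝ (energy L) p (hor Z) := by
  rw [hL.d2_vert_self hp]; simp [hor_apply]

theorem d3_vert_vert_self (X Y : Vec n) :
    d3 (energy L) p (vert X) (vert Y) (vert p.2) = 0 := by
  have := d2_comm hL.isOpen hL.contDiffOn_energy hp (vert X) (vert Y)
  rw [hL.d3_vert_self hp]; simp only [vert_apply] at *; linarith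

theorem d3_hor_vert_self (X Y : Vec n) :
    d3 (energy L) p (hor X) (vert Y) (vert p.2) = d2 (energy L) p (hor X) (vert Y) := by
  have h0 : (vert (hor X).2 : Vec n × Vec n) = 0 := map_zero vert
  rw [hL.d3_vert_self hp, h0, map_zero]; simp only [vert_apply]; ring

end IsFinslerOn

end Energy


/-! ## The spray, the nonlinear connection and the Cartan connection -/

namespace IsFinslerOn

variable {n : ℕ} {D : Set (Vec n × Vec n)} {L : Vec n × Vec n → ℝ} (hL : IsFinslerOn D L)

include hL

theorem contDiffOn_metric (i j : Fin n) : ContDiffOn ℝ ∞ (fun p => metric L p i j) D := by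
  refine ContDiffOn.congr (f := fun p => d2 (energy L) p (vert (Pi.single i 1))
    (vert (Pi.single j 1))) ?_ fun p hp => hL.metric_eq hp i j
  exact ((contDiffOn_d2 hL.isOpen hL.contDiffOn_energy).clm_apply contDiffOn_const).clm_apply
    contDiffOn_const

theorem contDiffOn_metricInv (i j : Fin n) : ContDiffOn ℝ ∞ (fun p => metricInv L p i j) D :=
  contDiffOn_matrix_inv hL.contDiffOn_metric (fun p hp => (hL.posDef p hp).det_pos.ne') i j

theorem contDiffOn_dx {F : Vec n × Vec n → ℝ} (hF : ContDiffOn ℝ ∞ F D) (i : Fin n) :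
    ContDiffOn ℝ ∞ (dx i F) D :=
  (contDiffOn_fderiv hL.isOpen hF).clm_apply contDiffOn_const

theorem contDiffOn_dy {F : Vec n × Vec n → ℝ} (hF : ContDiffOn ℝ ∞ F D) (i : Fin n) :
    ContDiffOn ℝ ∞ (dy i F) D :=
  (contDiffOn_fderiv hL.isOpen hF).clm_apply contDiffOn_const

theorem contDiffOn_cartanUp (i j k : Fin n) : ContDiffOn ℝ ∞ (cartanUp L i j k) D :=
  ContDiffOn.sum fun s _ => (hL.contDiffOn_metricInv i s).mul
    (contDiffOn_const.mul (hL.contDiffOn_dy (hL.contDiffOn_metric j k) s))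

omit hL in
theorem contDiff_snd_apply (j : Fin n) : ContDiff ℝ ∞ fun p : Vec n × Vec n => p.2 j :=
  (contDiff_apply ℝ ℝ j).comp contDiff_snd

theorem contDiffOn_spray (i : Fin n) : ContDiffOn ℝ ∞ (spray L i) D := by
  refine contDiffOn_const.mul (ContDiffOn.sum fun j _ => ContDiffOn.sum fun k _ =>
    ((contDiffOn_const.mul (ContDiffOn.sum fun r _ => (hL.contDiffOn_metricInv i r).mul ?_)).mul
    (contDiff_snd_apply j).contDiffOn).mul (contDiff_snd_apply k).contDiffOn)
  exact ((hL.contDiffOn_dx (hL.contDiffOn_metric r k) j).add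
    (hL.contDiffOn_dx (hL.contDiffOn_metric r j) k)).sub
    (hL.contDiffOn_dx (hL.contDiffOn_metric j k) r)

theorem contDiffOn_sprayVec : ContDiffOn ℝ ∞ (sprayVec L) D :=
  contDiffOn_pi.2 hL.contDiffOn_spray

theorem contDiffOn_nonlin (i j : Fin n) : ContDiffOn ℝ ∞ (nonlin L i j) D :=
  hL.contDiffOn_dy (hL.contDiffOn_spray i) j

theorem contDiffOn_delta {F : Vec n × Vec n → ℝ} (hF : ContDiffOn ℝ ∞ F D) (k : Fin n) :
    ContDiffOn ℝ ∞ (delta L k F) D :=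
  (hL.contDiffOn_dx hF k).sub (ContDiffOn.sum fun r _ => (hL.contDiffOn_nonlin r k).mul
    (hL.contDiffOn_dy hF r))

theorem contDiffOn_hConn (i j k : Fin n) : ContDiffOn ℝ ∞ (hConn L i j k) D := by
  refine contDiffOn_const.mul (ContDiffOn.sum fun r _ => (hL.contDiffOn_metricInv i r).mul ?_)
  exact ((hL.contDiffOn_delta (hL.contDiffOn_metric r k) j).add
    (hL.contDiffOn_delta (hL.contDiffOn_metric r j) k)).sub
    (hL.contDiffOn_delta (hL.contDiffOn_metric j k) r)

variable {p : Vec n × Vec n} (hp : p ∈ D)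

include hp

theorem dx_metric (k i j : Fin n) : dx k (fun q => metric L q i j) p =
    d3 (energy L) p (hor (Pi.single k 1)) (vert (Pi.single i 1)) (vert (Pi.single j 1)) :=
  hL.fderiv_metric hp i j _

theorem spray_eq (i : Fin n) : spray L i p = ∑ r, metricInv L p i r *
    ((1 / 2) * (d2 (energy L) p (hor p.2) (vert (Pi.single r 1))
      - fderiv ℝ (energy L) p (hor (Pi.single r 1)))) := by
  have key : ∀ r : Fin n, d2 (energy L) p (hor p.2) (vert (Pi.single r 1))
      - fderiv ℝ (energy L) p (hor (Pi.single r 1)) = (1 / 2) * ∑ j, ∑ k,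
        (dx j (fun q => metric L q r k) p + dx k (fun q => metric L q r j) p
          - dx r (fun q => metric L q j k) p) * p.2 j * p.2 k := by
    intro r
    -- Contraction with `y` lowers the order by homogeneity: two of the Christoffel terms become the
    -- mixed derivative, the third becomes `2 ∂_r E`.
    have e1 : ∑ j, ∑ k, dx j (fun q => metric L q r k) p * p.2 j * p.2 k =
        d2 (energy L) p (hor p.2) (vert (Pi.single r 1)) := by
      rw [← hL.d3_hor_vert_self hp, hor_eq_sum p.2]
      simp only [map_sum, map_smul, sum_apply, smul_apply, smul_eq_mul, hL.dx_metric hp]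
      refine Finset.sum_congr rfl fun j _ => ?_
      conv_rhs => rw [vert_eq_sum p.2]
      simp only [map_sum, map_smul, smul_eq_mul, Finset.mul_sum]
      exact Finset.sum_congr rfl fun k _ => by ring
    have e2 : ∑ j, ∑ k, dx k (fun q => metric L q r j) p * p.2 j * p.2 k =
        d2 (energy L) p (hor p.2) (vert (Pi.single r 1)) := by
      rw [← e1, Finset.sum_comm]
      exact Finset.sum_congr rfl fun k _ => Finset.sum_congr rfl fun j _ => by ring
    have e3 : ∑ j, ∑ k, dx r (fun q => metric L q j k) p * p.2 j * p.2 k =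
        2 * fderiv ℝ (energy L) p (hor (Pi.single r 1)) := by
      rw [← hL.d2_hor_vert_self hp, ← hL.d3_hor_vert_self hp]
      conv_rhs => enter [1]; rw [vert_eq_sum p.2]
      simp only [map_sum, map_smul, sum_apply, smul_apply, smul_eq_mul, hL.dx_metric hp]
      refine Finset.sum_congr rfl fun j _ => ?_
      rw [vert_eq_sum p.2]
      simp only [map_sum, map_smul, smul_eq_mul, Finset.mul_sum]
      exact Finset.sum_congr rfl fun k _ => by ring
    simp only [sub_mul, add_mul, Finset.sum_sub_distrib, Finset.sum_add_distrib, e1, e2, e3]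
    ring
  simp only [key, spray, christoffel, Finset.mul_sum, Finset.sum_mul]
  rw [Finset.sum_comm]
  refine (Finset.sum_congr rfl fun k _ => Finset.sum_comm).trans ?_
  rw [Finset.sum_comm]
  refine Finset.sum_congr rfl fun r _ => ?_
  rw [Finset.sum_comm]
  exact Finset.sum_congr rfl fun j _ => Finset.sum_congr rfl fun k _ => by ring

/-- The spray equation, i.e. the Euler-Lagrange equation of the energy. -/
theorem euler_lagrange (Z : Vec n) :
    d2 (energy L) p (sprayField L p) (vert Z) = fderiv ℝ (energy L) p (hor Z) := by
  have h := hL.d2_vert_of_eq_metricInv hp (W := sprayVec L p) (hL.spray_eq hp) Z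
  have h2 : ∑ r, (1 / 2) * (d2 (energy L) p (hor p.2) (vert (Pi.single r 1))
      - fderiv ℝ (energy L) p (hor (Pi.single r 1))) * Z r =
      (1 / 2) * (d2 (energy L) p (hor p.2) (vert Z) - fderiv ℝ (energy L) p (hor Z)) := by
    rw [vert_eq_sum Z, hor_eq_sum Z]
    simp only [map_sum, map_smul, smul_eq_mul, ← Finset.sum_sub_distrib, Finset.mul_sum]
    exact Finset.sum_congr rfl fun k _ => by ring
  simp only [sprayField, map_sub, map_smul, sub_apply, smul_apply, smul_eq_mul, h, h2]
  ring

theorem hasFDerivAt_sprayVec : HasFDerivAt (sprayVec L) (fderiv ℝ (sprayVec L) p) p :=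
  hasFDerivAt_of_contDiffOn hL.isOpen hL.contDiffOn_sprayVec hp

theorem nonlin_eq (i j : Fin n) : nonlin L i j p = nonlinMap L p (Pi.single j 1) i := by
  have h := hasFDerivAt_pi'.1 (hL.hasFDerivAt_sprayVec hp) i
  change fderiv ℝ (fun q => sprayVec L q i) p _ = _
  rw [h.fderiv]; rfl

theorem nonlinMap_apply (X : Vec n) (i : Fin n) : nonlinMap L p X i = ∑ j, nonlin L i j p * X j := by
  simp only [hL.nonlin_eq hp]
  conv_lhs => rw [vec_eq_sum X]
  simp only [map_sum, map_smul, Finset.sum_apply, Pi.smul_apply, smul_eq_mul]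
  exact Finset.sum_congr rfl fun k _ => by ring

theorem hasDerivAt_sprayField_line (w : Vec n × Vec n) :
    HasDerivAt (fun s : ℝ => sprayField L (p + s • w))
      (hor w.2 - (2 : ℝ) • vert (fderiv ℝ (sprayVec L) p w)) 0 := by
  have hl := hasDerivAt_line p w
  have hp0 : p + (0 : ℝ) • w ∈ D := by simpa using hp
  have h1 := hasDerivAt_comp_of_contDiffOn hL.isOpen hL.contDiffOn_sprayVec hp0 hl
  rw [zero_smul, add_zero] at h1
  exact (hor.hasFDerivAt.comp_hasDerivAt (0 : ℝ) hl.snd).sub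
    ((vert.hasFDerivAt.comp_hasDerivAt (0 : ℝ) h1).const_smul (2 : ℝ))

/-- The vertical derivative of the spray equation. -/
theorem nonlinMap_eq (Y Z : Vec n) :
    2 * d2 (energy L) p (vert (nonlinMap L p Y)) (vert Z) =
      d3 (energy L) p (sprayField L p) (vert Y) (vert Z) + d2 (energy L) p (hor Y) (vert Z)
        - d2 (energy L) p (hor Z) (vert Y) := by
  have hl := hasDerivAt_line p (vert Y)
  have hp0 : p + (0 : ℝ) • vert Y ∈ D := by simpa using hp
  -- The spray field has derivative `hor Y - 2 vert (N Y)` in the vertical direction `Y`; this is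
  -- the origin of the factor 2.
  have h1 := hasDerivAt_d2_apply hL.isOpen hL.contDiffOn_energy hp0 hl
    (hL.hasDerivAt_sprayField_line hp (vert Y)) (hasDerivAt_const 0 (vert Z))
  have h2 := hasDerivAt_d1_apply hL.isOpen hL.contDiffOn_energy hp0 hl
    (hasDerivAt_const 0 (hor Z))
  have h := deriv_eq_of_eqOn hL.isOpen hl.continuousAt hp0 (fun s hs => hL.euler_lagrange hs Z)
    h1 h2
  simp only [zero_smul, add_zero, map_zero, map_sub, map_smul, sub_apply, smul_apply,
    smul_eq_mul] at h
  rw [d3_comm_left hL.isOpen hL.contDiffOn_energy hp,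
    d2_comm hL.isOpen hL.contDiffOn_energy hp (vert Y) (hor Z)] at h
  simp only [nonlinMap, ContinuousLinearMap.comp_apply, vert_apply] at h ⊢
  linarith

/-- The metric is parallel along the spray. -/
theorem d3_sprayField (Y Z : Vec n) : d3 (energy L) p (sprayField L p) (vert Y) (vert Z) =
    d2 (energy L) p (vert (nonlinMap L p Y)) (vert Z)
      + d2 (energy L) p (vert Y) (vert (nonlinMap L p Z)) := by
  have h1 := hL.nonlinMap_eq hp Y Z
  have h2 := hL.nonlinMap_eq hp Z Y
  rw [d2_comm hL.isOpen hL.contDiffOn_energy hp (vert Y)]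
  rw [d3_comm_right hL.isOpen hL.contDiffOn_energy hp] at h2
  linarith

/-- Homogeneity of the spray, read off from `nonlinMap_eq` at `Y = y` and the Euler-Lagrange
equation. It identifies the horizontal lift of `y` with the spray. -/
theorem nonlinMap_self : nonlinMap L p p.2 = (2 : ℝ) • sprayVec L p := by
  refine hL.eq_of_d2_vert hp fun Z => ?_
  have h1 := hL.nonlinMap_eq hp p.2 Z
  have h2 := hL.euler_lagrange hp Z
  rw [d3_comm_right hL.isOpen hL.contDiffOn_energy hp, hL.d2_hor_vert_self hp] at h1
  simp only [sprayField, map_sub, map_smul, sub_apply, smul_apply, smul_eq_mul,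
    hL.d3_vert_vert_self hp, hL.d3_hor_vert_self hp] at h1 h2 ⊢
  linarith

theorem hlift_self : hlift L p p.2 = sprayField L p := by
  rw [hlift_apply, hL.nonlinMap_self hp, map_smul, sprayField]

theorem delta_eq {F : Vec n × Vec n → ℝ} (k : Fin n) :
    delta L k F p = fderiv ℝ F p (hlift L p (Pi.single k 1)) := by
  simp only [delta, dx, dy, hL.nonlin_eq hp, hlift_apply, map_sub]
  rw [vert_eq_sum (nonlinMap L p (Pi.single k 1))]
  simp only [map_sum, map_smul, smul_eq_mul]
  rfl

/-- The Christoffel formula for the horizontal coefficients. -/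
theorem hConnVec_eq (X Y Z : Vec n) :
    2 * d2 (energy L) p (vert (hConnVec L p X Y)) (vert Z) =
      d3 (energy L) p (hlift L p X) (vert Y) (vert Z)
        + d3 (energy L) p (hlift L p Y) (vert X) (vert Z)
        - d3 (energy L) p (hlift L p Z) (vert X) (vert Y) := by
  -- On coordinate vectors this is the definition with one index lowered; the general case follows
  -- by bilinearity.
  have hc : ∀ j k : Fin n, 2 * d2 (energy L) p (vert fun i => hConn L i j k p) (vert Z) =
      d3 (energy L) p (hlift L p (Pi.single j 1)) (vert (Pi.single k 1)) (vert Z)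
        + d3 (energy L) p (hlift L p (Pi.single k 1)) (vert (Pi.single j 1)) (vert Z)
        - d3 (energy L) p (hlift L p Z) (vert (Pi.single j 1)) (vert (Pi.single k 1)) := by
    intro j k
    rw [hL.d2_vert_of_eq_metricInv hp (c := fun r => (1 / 2) *
      (delta L j (fun q => metric L q r k) p + delta L k (fun q => metric L q r j) p
      - delta L r (fun q => metric L q j k) p))]
    · simp only [hL.delta_eq hp, hL.fderiv_metric hp]
      conv_rhs => rw [vec_eq_sum Z]
      simp only [map_sum, map_smul, sum_apply, smul_apply, smul_eq_mul, Finset.mul_sum,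
        ← Finset.sum_add_distrib, ← Finset.sum_sub_distrib]
      refine Finset.sum_congr rfl fun r _ => ?_
      rw [d3_comm_right hL.isOpen hL.contDiffOn_energy hp _ (vert (Pi.single r 1)),
        d3_comm_right hL.isOpen hL.contDiffOn_energy hp _ (vert (Pi.single r 1))]
      ring
    · intro i
      simp only [hConn, Finset.mul_sum]
      exact Finset.sum_congr rfl fun r _ => by ring
  have e : hConnVec L p X Y = ∑ j, ∑ k, (X j * Y k) • fun i => hConn L i j k p := by
    ext i
    simp only [hConnVec, Finset.sum_apply, Pi.smul_apply, smul_eq_mul]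
    exact Finset.sum_congr rfl fun j _ => Finset.sum_congr rfl fun k _ => by ring
  have expand : ∀ (a : Vec n →L[ℝ] Vec n × Vec n) (T : (Vec n × Vec n) →L[ℝ] (Vec n × Vec n) →L[ℝ] ℝ)
      (X Y : Vec n), T (a X) (vert Y) =
        ∑ j, ∑ k, (X j * Y k) * T (a (Pi.single j 1)) (vert (Pi.single k 1)) := by
    intro a T X Y
    conv_lhs => rw [vec_eq_sum X]
    simp only [map_sum, map_smul, sum_apply, smul_apply, smul_eq_mul]
    refine Finset.sum_congr rfl fun j _ => ?_
    conv_lhs => rw [vert_eq_sum Y]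
    simp only [map_sum, map_smul, smul_eq_mul, Finset.mul_sum]
    exact Finset.sum_congr rfl fun k _ => by ring
  have e1 : ∀ X Y, d3 (energy L) p (hlift L p X) (vert Y) (vert Z) = ∑ j, ∑ k, (X j * Y k) *
      d3 (energy L) p (hlift L p (Pi.single j 1)) (vert (Pi.single k 1)) (vert Z) := by
    intro X Y
    have hs : ∀ a b, d3 (energy L) p a b (vert Z) = d3 (energy L) p (vert Z) a b := fun a b => by
      rw [d3_comm_right hL.isOpen hL.contDiffOn_energy hp,
        d3_comm_left hL.isOpen hL.contDiffOn_energy hp]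
    simpa only [hs] using expand (hlift L p) (d3 (energy L) p (vert Z)) X Y
  have e2 := expand vert (d3 (energy L) p (hlift L p Z)) X Y
  rw [e1 X Y, e1 Y X, e2, e, Finset.sum_comm (γ := Fin n) (f := fun j k => Y j * X k * _)]
  simp only [map_sum, map_smul, sum_apply, smul_apply, smul_eq_mul, Finset.mul_sum,
    ← Finset.sum_add_distrib, ← Finset.sum_sub_distrib]
  refine Finset.sum_congr rfl fun j _ => Finset.sum_congr rfl fun k _ => ?_
  linear_combination X j * Y k * hc j k

end IsFinslerOn


/-! ### Metric compatibility, deflection and the Berwald coefficients. -/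

namespace IsFinslerOn

variable {n : ℕ} {D : Set (Vec n × Vec n)} {L : Vec n × Vec n → ℝ} (hL : IsFinslerOn D L)
  {p : Vec n × Vec n} (hp : p ∈ D)

include hL hp

theorem hConnVec_comm (X Y : Vec n) : hConnVec L p X Y = hConnVec L p Y X := by
  refine hL.eq_of_d2_vert hp fun Z => ?_
  have h1 := hL.hConnVec_eq hp X Y Z
  have h2 := hL.hConnVec_eq hp Y X Z
  rw [d3_comm_right hL.isOpen hL.contDiffOn_energy hp (hlift L p Z)] at h2
  linarith

/-- The horizontal covariant derivative of the metric vanishes. -/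
theorem d3_hlift (X Y Z : Vec n) : d3 (energy L) p (hlift L p X) (vert Y) (vert Z) =
    d2 (energy L) p (vert (hConnVec L p X Y)) (vert Z)
      + d2 (energy L) p (vert Y) (vert (hConnVec L p X Z)) := by
  have h1 := hL.hConnVec_eq hp X Y Z
  have h2 := hL.hConnVec_eq hp X Z Y
  rw [d2_comm hL.isOpen hL.contDiffOn_energy hp (vert Y)]
  rw [d3_comm_right hL.isOpen hL.contDiffOn_energy hp (hlift L p X)] at h2
  linarith

/-- The deflection tensor vanishes: `F^i_0k = N^i_k`. -/
theorem hConnVec_self (Y : Vec n) : hConnVec L p p.2 Y = nonlinMap L p Y := by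
  refine hL.eq_of_d2_vert hp fun Z => ?_
  have h1 := hL.hConnVec_eq hp p.2 Y Z
  have h2 := hL.nonlinMap_eq hp Y Z
  rw [hL.hlift_self hp, d3_comm_right hL.isOpen hL.contDiffOn_energy hp (hlift L p Y),
    d3_comm_right hL.isOpen hL.contDiffOn_energy hp (hlift L p Z)] at h1
  -- With `y` in one slot the vertical parts of the lifts drop out by `C_ij0 = 0`, and the
  -- horizontal parts reduce to second derivatives, leaving the formula of `nonlinMap_eq`.
  simp only [hlift_apply, map_sub, sub_apply, hL.d3_hor_vert_self hp,
    hL.d3_vert_vert_self hp] at h1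
  linarith

theorem metric_mul_cartanUp (i j k : Fin n) :
    ∑ r, metric L p i r * cartanUp L r j k p = cartan L i j k p :=
  hL.metric_mulVec_metricInv hp (fun s => cartan L s j k p) i

theorem cartanVec_eq (X Y Z : Vec n) :
    2 * d2 (energy L) p (vert (cartanVec L p X Y)) (vert Z) =
      d3 (energy L) p (vert X) (vert Y) (vert Z) := by
  rw [d3_comm_right hL.isOpen hL.contDiffOn_energy hp,
    d3_comm_left hL.isOpen hL.contDiffOn_energy hp, hL.d3_vert_eq_sum hp,
    d2_comm hL.isOpen hL.contDiffOn_energy hp, hL.d2_vert_eq_sum hp]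
  congr 1
  refine Finset.sum_congr rfl fun i _ => ?_
  simp only [← hL.metric_mul_cartanUp hp, cartanVec, Finset.mul_sum, Finset.sum_mul]
  rw [Finset.sum_comm]
  refine Finset.sum_congr rfl fun j _ => ?_
  rw [Finset.sum_comm]
  exact Finset.sum_congr rfl fun k _ => Finset.sum_congr rfl fun r _ => by ring

/-- The derivative of the metric in the direction `(x', y')` by the Cartan connection. -/
theorem d3_eq_covariant (x' y' X Y : Vec n) :
    d3 (energy L) p (hor x' + vert y') (vert X) (vert Y) =
      d2 (energy L) p (vert (hConnVec L p X x' + cartanVec L p X (y' + nonlinMap L p x'))) (vert Y)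
      + d2 (energy L) p (vert X)
          (vert (hConnVec L p Y x' + cartanVec L p Y (y' + nonlinMap L p x'))) := by
  have hE := hL.contDiffOn_energy
  have h1 := hL.d3_hlift hp x' X Y
  set η := y' + nonlinMap L p x' with hη
  have h2 := hL.cartanVec_eq hp X η Y
  have h3 := hL.cartanVec_eq hp Y η X
  -- The velocity splits into a horizontal lift, handled by metric compatibility, and a vertical
  -- rest, handled by the Cartan tensor.
  have e : hor x' + vert y' = hlift L p x' + vert η := by
    rw [hlift_apply, hη, map_add]; abel
  rw [d3_comm_left hL.isOpen hE hp] at h2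
  rw [d3_comm_left hL.isOpen hE hp, d3_comm_right hL.isOpen hE hp,
    d2_comm hL.isOpen hE hp] at h3
  rw [hL.hConnVec_comm hp X, hL.hConnVec_comm hp Y, e]
  simp only [map_add, add_apply]
  linarith

/-- The Berwald coefficients differ from the Cartan ones by the Landsberg tensor. -/
theorem berwald_eq (X Y Z : Vec n) :
    2 * d2 (energy L) p (vert (fderiv ℝ (fun q => nonlinMap L q Y) p (vert X))) (vert Z) =
      2 * d2 (energy L) p (vert (hConnVec L p X Y)) (vert Z)
      + (d4 (energy L) p (sprayField L p) (vert X) (vert Y) (vert Z)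
        - d3 (energy L) p (vert (nonlinMap L p X)) (vert Y) (vert Z)
        - d3 (energy L) p (vert X) (vert (nonlinMap L p Y)) (vert Z)
        - d3 (energy L) p (vert X) (vert Y) (vert (nonlinMap L p Z))) := by
  have hE := hL.contDiffOn_energy
  have hl := hasDerivAt_line p (vert X)
  have hp0 : p + (0 : ℝ) • vert X ∈ D := by simpa using hp
  have hN : ContDiffOn ℝ ∞ (fun q => nonlinMap L q Y) D :=
    (contDiffOn_fderiv hL.isOpen hL.contDiffOn_sprayVec).clm_apply contDiffOn_const
  have hN' : HasDerivAt (fun s : ℝ => vert (nonlinMap L (p + s • vert X) Y))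
      (vert (fderiv ℝ (fun q => nonlinMap L q Y) p (vert X))) 0 := by
    have := hasDerivAt_comp_of_contDiffOn hL.isOpen hN hp0 hl
    rw [zero_smul, add_zero] at this
    exact vert.hasFDerivAt.comp_hasDerivAt (0 : ℝ) this
  -- The identity `nonlinMap_eq` is differentiated in the vertical direction `X`. The Christoffel
  -- formula absorbs the terms with `hor`; the derivative of the Cartan tensor along the spray
  -- remains.
  have h1 := (hasDerivAt_d2_apply hL.isOpen hE hp0 hl hN' (hasDerivAt_const 0 (vert Z))).const_mul 2
  have h2 := ((hasDerivAt_d3_apply hL.isOpen hE hp0 hl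
    (hL.hasDerivAt_sprayField_line hp (vert X)) (hasDerivAt_const 0 (vert Y))
    (hasDerivAt_const 0 (vert Z))).add (hasDerivAt_d2_apply hL.isOpen hE hp0 hl
    (hasDerivAt_const 0 (hor Y)) (hasDerivAt_const 0 (vert Z)))).sub
    (hasDerivAt_d2_apply hL.isOpen hE hp0 hl (hasDerivAt_const 0 (hor Z))
      (hasDerivAt_const 0 (vert Y)))
  have h := deriv_eq_of_eqOn hL.isOpen hl.continuousAt hp0 (fun s hs => hL.nonlinMap_eq hs Y Z)
    h1 h2
  have hF := hL.hConnVec_eq hp X Y Z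
  have hN1 : fderiv ℝ (sprayVec L) p (vert X) = nonlinMap L p X := rfl
  have hX : (vert X : Vec n × Vec n).2 = X := rfl
  simp only [zero_smul, add_zero, map_zero, map_sub, map_smul, sub_apply, smul_apply,
    smul_eq_mul, hlift_apply, zero_apply, hN1, hX] at h hF ⊢
  have s1 := d4_comm_left hL.isOpen hE hp (vert X) (sprayField L p) (vert Y) (vert Z)
  have s2 := d3_comm_left hL.isOpen hE hp (vert X) (vert (nonlinMap L p Y)) (vert Z)
  have s3 := d3_comm_left hL.isOpen hE hp (vert X) (hor Y) (vert Z)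
  have s4 := d3_comm_left hL.isOpen hE hp (vert X) (hor Z) (vert Y)
  have s5 := d3_comm_right hL.isOpen hE hp (vert X) (vert Y) (vert (nonlinMap L p Z))
  have s6 := d3_comm_left hL.isOpen hE hp (vert X) (vert (nonlinMap L p Z)) (vert Y)
  linarith

end IsFinslerOn


/-! ## Immersed submanifolds in coordinates -/

variable {m n : ℕ}

/-- `φ` is a smooth immersion on the open set `U`. -/
structure IsImmersionOn (φ : Vec m → Vec n) (U : Set (Vec m)) : Prop where
  isOpen : IsOpen U
  smooth : ContDiffOn ℝ ∞ φ U
  injective : ∀ u ∈ U, Function.Injective (fderiv ℝ φ u)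

/-- The vector `B^i_0β c^β + N^i_j B^j_β c^β`. -/
def dirVec (L : Vec n × Vec n → ℝ) (φ : Vec m → Vec n) (q : Vec m × Vec m) (c : Vec m) : Vec n :=
  fderiv ℝ (fderiv ℝ φ) q.1 c q.2 + nonlinMap L (lift φ q) (fderiv ℝ φ q.1 c)

/-- The vector `B^α_i W^i`. -/
def projVec (L : Vec n × Vec n → ℝ) (φ : Vec m → Vec n) (q : Vec m × Vec m) (W : Vec n) : Vec m :=
  fun α => ∑ i, projInv L φ α i q * W i

/-- `X` is normal to the submanifold at `q`. -/
def IsNormalVec (L : Vec n × Vec n → ℝ) (φ : Vec m → Vec n) (q : Vec m × Vec m) (X : Vec n) :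
    Prop :=
  ∀ c, d2 (energy L) (lift φ q) (vert (fderiv ℝ φ q.1 c)) (vert X) = 0

namespace IsImmersionOn

variable {φ : Vec m → Vec n} {U : Set (Vec m)} (hφ : IsImmersionOn φ U)

include hφ

theorem contDiffOn_fderiv_fst :
    ContDiffOn ℝ ∞ (fun q : Vec m × Vec m => fderiv ℝ φ q.1) {q | q.1 ∈ U} :=
  (contDiffOn_fderiv hφ.isOpen hφ.smooth).comp contDiffOn_fst fun _ h => h

theorem isOpen_fst : IsOpen {q : Vec m × Vec m | q.1 ∈ U} := hφ.isOpen.preimage continuous_fst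

theorem contDiffOn_lift : ContDiffOn ℝ ∞ (lift φ) {q | q.1 ∈ U} :=
  ((hφ.smooth.comp contDiffOn_fst fun _ h => h).prodMk
    (hφ.contDiffOn_fderiv_fst.clm_apply contDiffOn_snd))

theorem isOpen_liftDomain {D : Set (Vec n × Vec n)} (hD : IsOpen D) :
    IsOpen (liftDomain φ U D) :=
  hφ.contDiffOn_lift.continuousOn.isOpen_inter_preimage hφ.isOpen_fst hD

theorem contDiffOn_lift_liftDomain (D : Set (Vec n × Vec n)) :
    ContDiffOn ℝ ∞ (lift φ) (liftDomain φ U D) :=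
  hφ.contDiffOn_lift.mono fun _ h => h.1

theorem hasDerivAt_fderiv {u : ℝ → Vec m} {u' : Vec m} {t : ℝ} (ht : u t ∈ U)
    (hu : HasDerivAt u u' t) :
    HasDerivAt (fun s => fderiv ℝ φ (u s)) (fderiv ℝ (fderiv ℝ φ) (u t) u') t :=
  hasDerivAt_comp_of_contDiffOn hφ.isOpen (contDiffOn_fderiv hφ.isOpen hφ.smooth) ht hu

theorem hasDerivAt_fderiv_apply {u v : ℝ → Vec m} {u' v' : Vec m} {t : ℝ} (ht : u t ∈ U)
    (hu : HasDerivAt u u' t) (hv : HasDerivAt v v' t) :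
    HasDerivAt (fun s => fderiv ℝ φ (u s) (v s))
      (fderiv ℝ (fderiv ℝ φ) (u t) u' (v t) + fderiv ℝ φ (u t) v') t :=
  (hφ.hasDerivAt_fderiv ht hu).clm_apply hv

theorem hasDerivAt_comp {u : ℝ → Vec m} {u' : Vec m} {t : ℝ} (ht : u t ∈ U)
    (hu : HasDerivAt u u' t) : HasDerivAt (fun s => φ (u s)) (fderiv ℝ φ (u t) u') t :=
  hasDerivAt_comp_of_contDiffOn hφ.isOpen hφ.smooth ht hu

theorem hasDerivAt_lift {u v : ℝ → Vec m} {u' v' : Vec m} {t : ℝ} (ht : u t ∈ U)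
    (hu : HasDerivAt u u' t) (hv : HasDerivAt v v' t) :
    HasDerivAt (fun s => lift φ (u s, v s)) (hor (fderiv ℝ φ (u t) u')
      + vert (fderiv ℝ (fderiv ℝ φ) (u t) u' (v t) + fderiv ℝ φ (u t) v')) t := by
  rw [← mk_eq_hor_add_vert]
  exact (hφ.hasDerivAt_comp ht hu).prodMk (hφ.hasDerivAt_fderiv_apply ht hu hv)

theorem hasDerivAt_lift_line {q : Vec m × Vec m} (hq : q.1 ∈ U) (w : Vec m × Vec m) :
    HasDerivAt (fun s : ℝ => lift φ (q + s • w)) (hor (fderiv ℝ φ q.1 w.1)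
      + vert (fderiv ℝ (fderiv ℝ φ) q.1 w.1 q.2 + fderiv ℝ φ q.1 w.2)) 0 := by
  have hl := hasDerivAt_line q w
  have := hφ.hasDerivAt_lift (u := fun s => (q + s • w).1) (v := fun s => (q + s • w).2) (t := 0)
    (by simpa using hq) hl.fst hl.snd
  simp only [zero_smul, add_zero] at this
  exact this

theorem proj2_eq {u : Vec m} (hu : u ∈ U) (i : Fin n) (α β : Fin m) :
    proj2 φ i α β u = fderiv ℝ (fderiv ℝ φ) u (Pi.single β 1) (Pi.single α 1) i := by
  have h := hasFDerivAt_of_contDiffOn hφ.isOpen (contDiffOn_fderiv hφ.isOpen hφ.smooth) hu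
  have h2 := hasFDerivAt_pi'.1 (h.clm_apply (hasFDerivAt_const (Pi.single α 1 : Vec m) u)) i
  change fderiv ℝ (fun u => fderiv ℝ φ u (Pi.single α 1) i) u _ = _
  rw [h2.fderiv]; simp

theorem fderiv_fderiv_symm {u : Vec m} (hu : u ∈ U) (a b : Vec m) :
    fderiv ℝ (fderiv ℝ φ) u a b = fderiv ℝ (fderiv ℝ φ) u b a :=
  fderiv_fderiv_comm hφ.isOpen hφ.smooth hu a b

/-! ### The induced metric, orthogonal projection and normal vectors. -/

section Finsler

variable {D : Set (Vec n × Vec n)} {L : Vec n × Vec n → ℝ} (hL : IsFinslerOn D L)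

include hL

theorem contDiffOn_energy_induced : ContDiffOn ℝ ∞ (energy (inducedL L φ)) (liftDomain φ U D) :=
  hL.contDiffOn_energy.comp (hφ.contDiffOn_lift_liftDomain D) fun _ h => h.2

variable {q : Vec m × Vec m} (hq : q ∈ liftDomain φ U D)

include hq

theorem fderiv_energy_induced (c : Vec m) :
    fderiv ℝ (energy (inducedL L φ)) q (vert c) =
      fderiv ℝ (energy L) (lift φ q) (vert (fderiv ℝ φ q.1 c)) := by
  have hl := hasDerivAt_line q (vert c)
  have h1 := hasDerivAt_comp_of_contDiffOn (hφ.isOpen_liftDomain hL.isOpen)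
    (hφ.contDiffOn_energy_induced hL) (by simpa using hq) hl
  have h2 := hasDerivAt_comp_of_contDiffOn (γ := fun s : ℝ => lift φ (q + s • vert c)) (t := 0)
    hL.isOpen hL.contDiffOn_energy (by simpa using hq.2) (hφ.hasDerivAt_lift_line hq.1 (vert c))
  simpa [vert_apply, hor_apply] using h1.unique h2

/-- Over a fixed `u` the lift is linear in `v`, so the vertical Hessian of the energy pulls back
without correction terms. -/
theorem metric_induced (α β : Fin m) : metric (inducedL L φ) q α β =
    d2 (energy L) (lift φ q) (vert (fderiv ℝ φ q.1 (Pi.single α 1)))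
      (vert (fderiv ℝ φ q.1 (Pi.single β 1))) := by
  have hQ := hφ.isOpen_liftDomain hL.isOpen
  rw [metric_eq_d2 hQ (hφ.contDiffOn_energy_induced hL) hq]
  set a : Vec m := Pi.single α 1
  set b : Vec m := Pi.single β 1
  have hl := hasDerivAt_line q (vert a)
  have hq0 : q + (0 : ℝ) • vert a ∈ liftDomain φ U D := by simpa using hq
  have h1 := hasDerivAt_d1_apply hQ (hφ.contDiffOn_energy_induced hL) hq0 hl
    (hasDerivAt_const 0 (vert b))
  have h2 := hasDerivAt_d1_apply (γ := fun s : ℝ => lift φ (q + s • vert a)) (t := 0)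
    hL.isOpen hL.contDiffOn_energy hq0.2 (hφ.hasDerivAt_lift_line hq.1 (vert a))
    (hasDerivAt_const 0 (vert (fderiv ℝ φ q.1 b)))
  have := deriv_eq_of_eqOn hQ hl.continuousAt hq0 (fun s hs => ?_) h1 h2
  · simpa [vert_apply, hor_apply] using this
  · rw [hφ.fderiv_energy_induced hL hs]
    simp [vert_apply]

theorem sum_metric_induced (a b : Vec m) :
    ∑ α, ∑ β, metric (inducedL L φ) q α β * a α * b β =
      d2 (energy L) (lift φ q) (vert (fderiv ℝ φ q.1 a)) (vert (fderiv ℝ φ q.1 b)) := by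
  simp only [hφ.metric_induced hL hq]
  conv_rhs => rw [vec_eq_sum a]
  simp only [map_sum, map_smul, sum_apply, smul_apply, smul_eq_mul]
  refine Finset.sum_congr rfl fun α _ => ?_
  conv_rhs => rw [vec_eq_sum b]
  simp only [map_sum, map_smul, smul_eq_mul, Finset.mul_sum]
  exact Finset.sum_congr rfl fun β _ => by ring

theorem posDef_induced : (metric (inducedL L φ) q).PosDef := by
  refine Matrix.PosDef.of_dotProduct_mulVec_pos ?_ fun x hx => ?_
  · ext α β
    simp only [Matrix.conjTranspose_apply, star_trivial, hφ.metric_induced hL hq]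
    exact d2_comm hL.isOpen hL.contDiffOn_energy hq.2 _ _
  · have hB : fderiv ℝ φ q.1 x ≠ 0 := fun h =>
      hx (hφ.injective q.1 hq.1 (h.trans (map_zero _).symm))
    have := hL.d2_vert_pos hq.2 hB
    rw [← hφ.sum_metric_induced hL hq] at this
    refine this.trans_eq ?_
    simp only [dotProduct, Matrix.mulVec, star_trivial, Finset.mul_sum]
    exact Finset.sum_congr rfl fun i _ => Finset.sum_congr rfl fun j _ => by ring

/-- `B^i_α B^α_j` is the orthogonal projection to the tangent space. -/
theorem d2_projVec (W : Vec n) (c : Vec m) :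
    d2 (energy L) (lift φ q) (vert (fderiv ℝ φ q.1 (projVec L φ q W)))
      (vert (fderiv ℝ φ q.1 c)) =
    d2 (energy L) (lift φ q) (vert W) (vert (fderiv ℝ φ q.1 c)) := by
  have hdet : IsUnit (metric (inducedL L φ) q).det :=
    (Matrix.isUnit_iff_isUnit_det _).1 (hφ.posDef_induced hL hq).isUnit
  set w : Vec m := fun β => d2 (energy L) (lift φ q) (vert W)
    (vert (fderiv ℝ φ q.1 (Pi.single β 1))) with hw
  have e : projVec L φ q W = Matrix.mulVec (metric (inducedL L φ) q)⁻¹ w := by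
    ext α
    simp only [projVec, projInv, Matrix.mulVec, dotProduct, hw, hL.d2_vert_eq_sum hq.2, proj,
      metricInv, Finset.sum_mul, Finset.mul_sum]
    rw [Finset.sum_comm]
    exact Finset.sum_congr rfl fun β _ => Finset.sum_congr rfl fun i _ =>
      Finset.sum_congr rfl fun j _ => by ring
  have e2 : Matrix.mulVec (metric (inducedL L φ) q) (projVec L φ q W) = w := by
    rw [e, Matrix.mulVec_mulVec, Matrix.mul_nonsing_inv _ hdet, Matrix.one_mulVec]
  have e3 : d2 (energy L) (lift φ q) (vert W) (vert (fderiv ℝ φ q.1 c)) = ∑ α, w α * c α := by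
    conv_lhs => rw [vec_eq_sum c]
    simp only [map_sum, map_smul, smul_eq_mul, hw]
    exact Finset.sum_congr rfl fun β _ => by ring
  rw [e3, ← e2, d2_comm hL.isOpen hL.contDiffOn_energy hq.2, ← hφ.sum_metric_induced hL hq]
  simp only [Matrix.mulVec, dotProduct, Finset.sum_mul]
  exact Finset.sum_congr rfl fun β _ => Finset.sum_congr rfl fun i _ => by ring

theorem isNormalVec_sub_projVec (W : Vec n) :
    IsNormalVec L φ q (W - fderiv ℝ φ q.1 (projVec L φ q W)) := by
  intro c
  rw [d2_comm hL.isOpen hL.contDiffOn_energy hq.2]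
  simp only [map_sub, sub_apply, hφ.d2_projVec hL hq, sub_self]

/-- The two candidates differ by a vector that is both tangential and normal, hence of length zero.
-/
theorem projVec_eq_of_isNormalVec {W : Vec n} {c : Vec m}
    (h : IsNormalVec L φ q (W - fderiv ℝ φ q.1 c)) : projVec L φ q W = c := by
  refine hφ.injective q.1 hq.1 ?_
  rw [← sub_eq_zero]
  refine hL.eq_zero_of_d2_vert_self hq.2 ?_
  have h1 := h (projVec L φ q W - c)
  have h2 := hφ.isNormalVec_sub_projVec hL hq W (projVec L φ q W - c)
  simp only [map_sub, sub_apply] at h1 h2 ⊢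
  linarith

theorem projVec_fderiv (c : Vec m) : projVec L φ q (fderiv ℝ φ q.1 c) = c :=
  hφ.projVec_eq_of_isNormalVec hL hq fun a => by rw [sub_self, map_zero, map_zero]

theorem exists_fderiv_eq_iff (W : Vec n) :
    (∃ c, fderiv ℝ φ q.1 c = W) ↔ fderiv ℝ φ q.1 (projVec L φ q W) = W := by
  refine ⟨?_, fun h => ⟨_, h⟩⟩
  rintro ⟨c, rfl⟩
  rw [hφ.projVec_fderiv hL hq]

/-- A vector that is orthogonal to all normal vectors is tangential. -/
theorem exists_fderiv_eq_of_normal {W : Vec n}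
    (h : ∀ X, IsNormalVec L φ q X → d2 (energy L) (lift φ q) (vert W) (vert X) = 0) :
    ∃ c, fderiv ℝ φ q.1 c = W := by
  refine ⟨projVec L φ q W, ?_⟩
  have hX := hφ.isNormalVec_sub_projVec hL hq W
  have h1 := h _ hX
  have h2 := hX (projVec L φ q W)
  refine (sub_eq_zero.1 (hL.eq_zero_of_d2_vert_self hq.2 ?_)).symm
  simp only [map_sub, sub_apply] at h1 h2 ⊢
  linarith

omit hφ in
theorem isUnitNormal_iff (X : Vec n) : IsUnitNormal L φ q X ↔
    IsNormalVec L φ q X ∧ d2 (energy L) (lift φ q) (vert X) (vert X) = 1 := by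
  have e : ∀ α, ∑ i, ∑ j, metric L (lift φ q) i j * proj φ i α q.1 * X j =
      d2 (energy L) (lift φ q) (vert (fderiv ℝ φ q.1 (Pi.single α 1))) (vert X) := fun α =>
    (hL.d2_vert_eq_sum hq.2 _ _).symm
  simp only [IsUnitNormal, e, ← hL.d2_vert_eq_sum hq.2]
  refine and_congr_left fun _ => ⟨fun h c => ?_, fun h α => h _⟩
  rw [vec_eq_sum c]
  simp [map_sum, sum_apply, h]

omit hφ in
/-- A nonzero normal vector can be normalized. -/
theorem isUnitNormal_smul {X : Vec n} (hX : IsNormalVec L φ q X) (h0 : X ≠ 0) :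
    IsUnitNormal L φ q ((Real.sqrt (d2 (energy L) (lift φ q) (vert X) (vert X)))⁻¹ • X) := by
  have hpos := hL.d2_vert_pos hq.2 h0
  rw [isUnitNormal_iff hL hq]
  refine ⟨fun c => ?_, ?_⟩
  · rw [map_smul, map_smul, hX c, smul_zero]
  · simp only [map_smul, smul_apply, smul_eq_mul]
    have hs := Real.mul_self_sqrt hpos.le
    have hs0 := (Real.sqrt_pos.2 hpos).ne'
    field_simp
    rw [sq, hs]

omit hφ in
/-- A homogeneous property of unit normal vectors holds for all normal vectors. -/
theorem normal_induction {T : Vec n →ₗ[ℝ] ℝ} (h : ∀ X, IsUnitNormal L φ q X → T X = 0) {X : Vec n}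
    (hX : IsNormalVec L φ q X) : T X = 0 := by
  by_cases h0 : X = 0
  · rw [h0, map_zero]
  have h1 := h _ (isUnitNormal_smul hL hq hX h0)
  rw [map_smul, smul_eq_mul, mul_eq_zero] at h1
  exact h1.resolve_left (inv_ne_zero (Real.sqrt_pos.2 (hL.d2_vert_pos hq.2 h0)).ne')

theorem dirDeriv_eq (i : Fin n) (β : Fin m) :
    dirDeriv L φ i β q = dirVec L φ q (Pi.single β 1) i := by
  simp only [dirDeriv, dirVec, Pi.add_apply, hL.nonlinMap_apply hq.2, hφ.proj2_eq hq.1]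
  congr 1
  conv_rhs => rw [vec_eq_sum q.2]
  simp only [map_sum, map_smul, Finset.sum_apply, Pi.smul_apply, smul_eq_mul]
  exact Finset.sum_congr rfl fun α _ => by ring

theorem normalCurv_eq (i : Fin n) (β : Fin m) : normalCurv L φ i β q =
    (dirVec L φ q (Pi.single β 1)
      - fderiv ℝ φ q.1 (projVec L φ q (dirVec L φ q (Pi.single β 1)))) i := by
  rw [normalCurv, Pi.sub_apply, hφ.dirDeriv_eq hL hq]
  congr 1
  conv_rhs => rw [vec_eq_sum (projVec _ _ _ _)]
  simp only [map_sum, map_smul, Finset.sum_apply, Pi.smul_apply, smul_eq_mul, projVec,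
    Finset.sum_mul]
  refine Finset.sum_congr rfl fun α _ => Finset.sum_congr rfl fun j _ => ?_
  rw [hφ.dirDeriv_eq hL hq, proj]; ring

end Finsler

/-! ### Smoothness of the induced connection -/

section Smooth

variable {D : Set (Vec n × Vec n)} {L : Vec n × Vec n → ℝ} (hL : IsFinslerOn D L)

theorem contDiffOn_proj (D : Set (Vec n × Vec n)) (i : Fin n) (α : Fin m) :
    ContDiffOn ℝ ∞ (fun q : Vec m × Vec m => proj φ i α q.1) (liftDomain φ U D) :=
  contDiffOn_pi.1 ((hφ.contDiffOn_fderiv_fst.mono fun _ h => h.1).clm_apply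
    (contDiffOn_const (c := Pi.single α 1))) i

theorem contDiffOn_proj2 (D : Set (Vec n × Vec n)) (i : Fin n) (α β : Fin m) :
    ContDiffOn ℝ ∞ (fun q : Vec m × Vec m => proj2 φ i α β q.1) (liftDomain φ U D) := by
  have h : ContDiffOn ℝ ∞ (proj φ i α) U := contDiffOn_pi.1
    ((contDiffOn_fderiv hφ.isOpen hφ.smooth).clm_apply (contDiffOn_const (c := Pi.single α 1))) i
  exact ((contDiffOn_fderiv hφ.isOpen h).clm_apply contDiffOn_const).comp contDiffOn_fst
    fun _ h => h.1

omit hφ in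
theorem contDiffOn_snd_apply (D : Set (Vec n × Vec n)) (α : Fin m) :
    ContDiffOn ℝ ∞ (fun q : Vec m × Vec m => q.2 α) (liftDomain φ U D) :=
  (IsFinslerOn.contDiff_snd_apply α).contDiffOn

theorem contDiffOn_comp_lift {F : Vec n × Vec n → ℝ} (hF : ContDiffOn ℝ ∞ F D) :
    ContDiffOn ℝ ∞ (fun q => F (lift φ q)) (liftDomain φ U D) :=
  hF.comp (hφ.contDiffOn_lift_liftDomain D) fun _ h => h.2

include hL

theorem contDiffOn_projInv (α : Fin m) (i : Fin n) :
    ContDiffOn ℝ ∞ (projInv L φ α i) (liftDomain φ U D) := by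
  have hind : ∀ α β, ContDiffOn ℝ ∞ (fun q => metric (inducedL L φ) q α β) (liftDomain φ U D) := by
    intro α β
    refine ContDiffOn.congr ?_ fun q hq => hφ.metric_induced hL hq α β
    have hB : ∀ α : Fin m, ContDiffOn ℝ ∞
        (fun q : Vec m × Vec m => vert (fderiv ℝ φ q.1 (Pi.single α 1))) (liftDomain φ U D) :=
      fun α => vert.contDiff.comp_contDiffOn
        ((hφ.contDiffOn_fderiv_fst.mono fun _ h => h.1).clm_apply contDiffOn_const)
    exact (((contDiffOn_d2 hL.isOpen hL.contDiffOn_energy).comp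
      (hφ.contDiffOn_lift_liftDomain D) fun _ h => h.2).clm_apply (hB α)).clm_apply (hB β)
  exact ContDiffOn.sum fun β _ => ContDiffOn.sum fun j _ => ((contDiffOn_matrix_inv hind
    (fun q hq => (hφ.posDef_induced hL hq).det_pos.ne') α β).mul
    (hφ.contDiffOn_comp_lift (hL.contDiffOn_metric i j))).mul (hφ.contDiffOn_proj D j β)

theorem contDiffOn_dirDeriv (i : Fin n) (β : Fin m) :
    ContDiffOn ℝ ∞ (dirDeriv L φ i β) (liftDomain φ U D) :=
  (ContDiffOn.sum fun α _ => (hφ.contDiffOn_proj2 D i α β).mul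
    (contDiffOn_snd_apply D α)).add (ContDiffOn.sum fun j _ =>
      (hφ.contDiffOn_comp_lift (hL.contDiffOn_nonlin i j)).mul (hφ.contDiffOn_proj D j β))

theorem contDiffOn_normalCurv (i : Fin n) (β : Fin m) :
    ContDiffOn ℝ ∞ (normalCurv L φ i β) (liftDomain φ U D) :=
  (hφ.contDiffOn_dirDeriv hL i β).sub (ContDiffOn.sum fun α _ => ContDiffOn.sum fun j _ =>
    ((hφ.contDiffOn_proj D i α).mul (hφ.contDiffOn_projInv hL α j)).mul
      (hφ.contDiffOn_dirDeriv hL j β))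

theorem contDiffOn_inducedNonlin (α β : Fin m) :
    ContDiffOn ℝ ∞ (inducedNonlin L φ α β) (liftDomain φ U D) :=
  ContDiffOn.sum fun i _ => (hφ.contDiffOn_projInv hL α i).mul (hφ.contDiffOn_dirDeriv hL i β)

theorem contDiffOn_inducedHConn (α β γ : Fin m) :
    ContDiffOn ℝ ∞ (inducedHConn L φ α β γ) (liftDomain φ U D) := by
  refine ContDiffOn.sum fun i _ => (hφ.contDiffOn_projInv hL α i).mul
    (((hφ.contDiffOn_proj2 D i β γ).add (ContDiffOn.sum fun j _ => ContDiffOn.sum fun k _ => ?_)).add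
      (ContDiffOn.sum fun j _ => ContDiffOn.sum fun k _ => ?_))
  · exact ((hφ.contDiffOn_comp_lift (hL.contDiffOn_hConn i j k)).mul
      (hφ.contDiffOn_proj D j β)).mul (hφ.contDiffOn_proj D k γ)
  · exact ((hφ.contDiffOn_comp_lift (hL.contDiffOn_cartanUp i j k)).mul
      (hφ.contDiffOn_proj D j β)).mul (hφ.contDiffOn_normalCurv hL k γ)

theorem contDiffOn_projVec (W : Vec n) :
    ContDiffOn ℝ ∞ (fun q => projVec L φ q W) (liftDomain φ U D) :=
  contDiffOn_pi.2 fun α => ContDiffOn.sum fun i _ =>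
    (hφ.contDiffOn_projInv hL α i).mul contDiffOn_const

/-- A normal vector extends to a smooth field of normal vectors. -/
theorem contDiffOn_sub_projVec (W : Vec n) :
    ContDiffOn ℝ ∞ (fun q : Vec m × Vec m => W - fderiv ℝ φ q.1 (projVec L φ q W))
      (liftDomain φ U D) :=
  contDiffOn_const.sub ((hφ.contDiffOn_fderiv_fst.mono fun _ h => h.1).clm_apply
    (hφ.contDiffOn_projVec hL W))

end Smooth

end IsImmersionOn


/-! ## Submanifolds with vanishing normal curvature and second fundamental `v`-tensor -/

variable {m n : ℕ}

/-- The normal curvature vector `H_β` and the second fundamental `v`-tensor `M_αβ` vanish. -/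
structure IsFlatOn (D : Set (Vec n × Vec n)) (L : Vec n × Vec n → ℝ) (φ : Vec m → Vec n)
    (U : Set (Vec m)) : Prop where
  dirVec_tangent : ∀ q ∈ liftDomain φ U D, ∀ a, ∃ c, fderiv ℝ φ q.1 c = dirVec L φ q a
  cartan_eq_zero : ∀ q ∈ liftDomain φ U D, ∀ X, IsNormalVec L φ q X → ∀ a b,
    d3 (energy L) (lift φ q) (vert (fderiv ℝ φ q.1 a)) (vert (fderiv ℝ φ q.1 b)) (vert X) = 0

namespace IsImmersionOn

variable {φ : Vec m → Vec n} {U : Set (Vec m)} (hφ : IsImmersionOn φ U)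
  {D : Set (Vec n × Vec n)} {L : Vec n × Vec n → ℝ} (hL : IsFinslerOn D L)
  {q : Vec m × Vec m} (hq : q ∈ liftDomain φ U D)

include hφ hL hq

/-- A normal vector extends to a field of normal vectors along each line. -/
theorem exists_normal_line {X : Vec n} (hX : IsNormalVec L φ q X) (w : Vec m × Vec m) :
    ∃ (Y : ℝ → Vec n) (Y' : Vec n), Y 0 = X ∧ HasDerivAt Y Y' 0 ∧
      ∀ s : ℝ, q + s • w ∈ liftDomain φ U D → IsNormalVec L φ (q + s • w) (Y s) := by
  have hQ := hφ.isOpen_liftDomain hL.isOpen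
  refine ⟨fun s => X - fderiv ℝ φ (q + s • w).1 (projVec L φ (q + s • w) X), _, ?_,
    hasDerivAt_comp_of_contDiffOn hQ (hφ.contDiffOn_sub_projVec hL X)
      (by simpa using hq) (hasDerivAt_line q w), fun s hs => hφ.isNormalVec_sub_projVec hL hs X⟩
  have : projVec L φ q X = 0 :=
    hφ.projVec_eq_of_isNormalVec hL hq (by rwa [map_zero, sub_zero])
  simp [this]

/-- The vertical derivative of the normal curvature vector. -/
theorem d2_berwald_eq_zero (hflat : IsFlatOn D L φ U) {X : Vec n} (hX : IsNormalVec L φ q X)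
    (a b : Vec m) :
    d2 (energy L) (lift φ q) (vert (fderiv ℝ (fderiv ℝ φ) q.1 a b)) (vert X)
      + d2 (energy L) (lift φ q) (vert (fderiv ℝ (fun r => nonlinMap L r (fderiv ℝ φ q.1 a))
        (lift φ q) (vert (fderiv ℝ φ q.1 b)))) (vert X) = 0 := by
  have hQ := hφ.isOpen_liftDomain hL.isOpen
  have hl := hasDerivAt_line q (vert b)
  have hq0 : q + (0 : ℝ) • vert b ∈ liftDomain φ U D := by simpa using hq
  have hN : ContDiffOn ℝ ∞ (fun r => nonlinMap L r (fderiv ℝ φ q.1 a)) D :=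
    (contDiffOn_fderiv hL.isOpen hL.contDiffOn_sprayVec).clm_apply contDiffOn_const
  have h1 := hasDerivAt_comp_of_contDiffOn (γ := fun s : ℝ => lift φ (q + s • vert b)) (t := 0)
    hL.isOpen hN hq0.2 (hφ.hasDerivAt_lift_line hq.1 (vert b))
  have h2 := (fderiv ℝ (fderiv ℝ φ) q.1 a).hasFDerivAt.comp_hasDerivAt (0 : ℝ) hl.snd
  -- The metric and `X` are frozen at `q`: along a vertical line the tangent space does not move, so
  -- `X` stays orthogonal to it for the fixed metric.
  have h3 := (((d2 (energy L) (lift φ q)).flip (vert X)).comp vert).hasFDerivAt.comp_hasDerivAt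
    (0 : ℝ) (h2.add h1)
  have h := deriv_eq_of_eqOn hQ hl.continuousAt hq0 (g := fun _ => (0 : ℝ)) (fun s hs => ?_) h3
    (hasDerivAt_const _ _)
  · rw [← add_apply, ← map_add, ← map_add]
    simpa [vert_apply, hor_apply] using h
  · obtain ⟨c, hc⟩ := hflat.dirVec_tangent _ hs a
    have hs1 : (q + s • vert b).1 = q.1 := by simp [vert_apply]
    have := hX c
    rw [hs1] at hc
    rw [hc] at this
    simpa [dirVec, hs1] using this

/-- The vanishing of `D³E(B a, B b, X)` is differentiated along the spray. The derivatives of `B a`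
and `B b` are `-N(B a)` and `-N(B b)` up to tangential vectors, that of `X` is `-N X` up to a normal
vector; the corrections contribute nothing by flatness. -/
theorem nabla_cartan_eq_zero (hflat : IsFlatOn D L φ U) {X : Vec n} (hX : IsNormalVec L φ q X)
    (a b : Vec m) :
    d4 (energy L) (lift φ q) (sprayField L (lift φ q)) (vert (fderiv ℝ φ q.1 a))
        (vert (fderiv ℝ φ q.1 b)) (vert X)
      - d3 (energy L) (lift φ q) (vert (nonlinMap L (lift φ q) (fderiv ℝ φ q.1 a)))
          (vert (fderiv ℝ φ q.1 b)) (vert X)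
      - d3 (energy L) (lift φ q) (vert (fderiv ℝ φ q.1 a))
          (vert (nonlinMap L (lift φ q) (fderiv ℝ φ q.1 b))) (vert X)
      - d3 (energy L) (lift φ q) (vert (fderiv ℝ φ q.1 a)) (vert (fderiv ℝ φ q.1 b))
          (vert (nonlinMap L (lift φ q) X)) = 0 := by
  have hQ := hφ.isOpen_liftDomain hL.isOpen
  have hE := hL.contDiffOn_energy
  obtain ⟨d, hd⟩ := hflat.dirVec_tangent q hq q.2
  -- Since `B d = B_00 + 2G`, this direction gives the lifted line the velocity `B v` in position
  -- and `B_00 - B d = -2G` in direction, that is, the spray.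
  set w : Vec m × Vec m := (q.2, -d) with hw
  have hl := hasDerivAt_line q w
  have hq0 : q + (0 : ℝ) • w ∈ liftDomain φ U D := by simpa using hq
  obtain ⟨Y, Y', hY0, hY, hYn⟩ := hφ.exists_normal_line hL hq hX w
  have hγ := hφ.hasDerivAt_lift_line hq.1 w
  have hspray : hor (fderiv ℝ φ q.1 w.1) + vert (fderiv ℝ (fderiv ℝ φ) q.1 w.1 q.2
      + fderiv ℝ φ q.1 w.2) = sprayField L (lift φ q) := by
    have e : (lift φ q).2 = fderiv ℝ φ q.1 q.2 := rfl
    rw [← hL.hlift_self hq.2, hlift_apply, e]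
    simp only [hw, map_neg, hd, dirVec, map_add]
    abel
  rw [hspray] at hγ
  have hB : ∀ c : Vec m, HasDerivAt (fun s : ℝ => vert (fderiv ℝ φ (q + s • w).1 c))
      (vert (fderiv ℝ (fderiv ℝ φ) q.1 q.2 c)) 0 := fun c => by
    have := hφ.hasDerivAt_fderiv_apply (u := fun s : ℝ => (q + s • w).1) (t := 0)
      (by simpa using hq.1) hl.fst (hasDerivAt_const 0 c)
    simp only [zero_smul, add_zero, map_zero] at this
    exact vert.hasFDerivAt.comp_hasDerivAt (0 : ℝ) this
  have hYv := vert.hasFDerivAt.comp_hasDerivAt (0 : ℝ) hY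
  have hK : ∀ c : Vec m, fderiv ℝ (fderiv ℝ φ) q.1 q.2 c =
      dirVec L φ q c - nonlinMap L (lift φ q) (fderiv ℝ φ q.1 c) := fun c => by
    rw [hφ.fderiv_fderiv_symm hq.1, dirVec, add_sub_cancel_right]
  have h1 := deriv_eq_of_eqOn hQ hl.continuousAt hq0 (g := fun _ => (0 : ℝ))
    (fun s hs => hflat.cartan_eq_zero _ hs _ (hYn s hs) a b)
    (hasDerivAt_d3_apply (γ := fun s : ℝ => lift φ (q + s • w)) (t := 0) hL.isOpen hE hq0.2 hγ
      (hB a) (hB b) hYv) (hasDerivAt_const _ _)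
  have h2 : ∀ c, _ := fun c => deriv_eq_of_eqOn hQ hl.continuousAt hq0 (g := fun _ => (0 : ℝ))
    (fun s hs => hYn s hs c)
    (hasDerivAt_d2_apply (γ := fun s : ℝ => lift φ (q + s • w)) (t := 0) hL.isOpen hE hq0.2 hγ
      (hB c) hYv) (hasDerivAt_const _ _)
  simp only [zero_smul, add_zero, hY0, hK, map_sub, sub_apply] at h1 h2
  -- Differentiate `g(B c, Y) = 0`. The metric is parallel along the spray, so `g(K c, X) + g(B c,
  -- Y' + N X) = 0`, where `K c` denotes `dirVec` at `c`; it is tangential, so the first term is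
  -- zero.
  have hn : IsNormalVec L φ q (Y' + nonlinMap L (lift φ q) X) := fun c => by
    obtain ⟨c', hc'⟩ := hflat.dirVec_tangent q hq c
    have h3 := hX c'
    have h4 := h2 c
    rw [hL.d3_sprayField hq.2] at h4
    rw [hc'] at h3
    simp only [map_add]
    linarith
  have t1 := hflat.cartan_eq_zero q hq _ hn a b
  obtain ⟨a', ha'⟩ := hflat.dirVec_tangent q hq a
  obtain ⟨b', hb'⟩ := hflat.dirVec_tangent q hq b
  have t2 := hflat.cartan_eq_zero q hq _ hX a' b
  have t3 := hflat.cartan_eq_zero q hq _ hX a b'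
  rw [ha'] at t2
  rw [hb'] at t3
  simp only [map_add] at t1
  linarith

/-- The second fundamental `h`-tensor of a flat submanifold vanishes. -/
theorem second_fundamental_tangent (hflat : IsFlatOn D L φ U) (a b : Vec m) :
    ∃ c, fderiv ℝ φ q.1 c = fderiv ℝ (fderiv ℝ φ) q.1 a b
      + hConnVec L (lift φ q) (fderiv ℝ φ q.1 a) (fderiv ℝ φ q.1 b) := by
  refine hφ.exists_fderiv_eq_of_normal hL hq fun X hX => ?_
  have h1 := hφ.d2_berwald_eq_zero hL hq hflat hX a b
  have h2 := hφ.nabla_cartan_eq_zero hL hq hflat hX b a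
  have h3 := hL.berwald_eq hq.2 (fderiv ℝ φ q.1 b) (fderiv ℝ φ q.1 a) X
  rw [h2, hL.hConnVec_comm hq.2] at h3
  simp only [map_add, add_apply]
  linarith

end IsImmersionOn


/-! ## Hyperplanes of the second and of the third kind -/

variable {m n : ℕ}

theorem IsFinslerOn.covDerivAlong_eq {D : Set (Vec n × Vec n)} {L : Vec n × Vec n → ℝ}
    (hL : IsFinslerOn D L) {x y X : ℝ → Vec n} {x' y' X' : Vec n} {t : ℝ} (ht : (x t, y t) ∈ D)
    (hx : HasDerivAt x x' t) (hy : HasDerivAt y y' t) (hX : HasDerivAt X X' t) (i : Fin n) :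
    covDerivAlong L x y X t i = (X' + (hConnVec L (x t, y t) (X t) x'
      + cartanVec L (x t, y t) (X t) (y' + nonlinMap L (x t, y t) x'))) i := by
  simp only [covDerivAlong, hx.deriv, hy.deriv, hX.deriv, Pi.add_apply, hConnVec, cartanVec,
    hL.nonlinMap_apply ht, add_assoc]

namespace IsImmersionOn

variable {φ : Vec m → Vec n} {U : Set (Vec m)} (hφ : IsImmersionOn φ U)
  {D : Set (Vec n × Vec n)} {L : Vec n × Vec n → ℝ} (hL : IsFinslerOn D L)

theorem dirVec_eq_of_curve (L : Vec n × Vec n → ℝ) (φ : Vec m → Vec n) (q : Vec m × Vec m)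
    (u' v' : Vec m) :
    fderiv ℝ (fderiv ℝ φ) q.1 u' q.2 + fderiv ℝ φ q.1 v'
      + nonlinMap L (lift φ q) (fderiv ℝ φ q.1 u') = dirVec L φ q u' + fderiv ℝ φ q.1 v' := by
  rw [dirVec]; abel

include hφ hL

/-- The tangential part of the covariant derivative of a normal field along a curve of line
elements. -/
theorem d2_covariant_normal {u v : ℝ → Vec m} {X : ℝ → Vec n} {u' v' : Vec m} {X' : Vec n} {t : ℝ}
    (hu : HasDerivAt u u' t) (hv : HasDerivAt v v' t) (hX : HasDerivAt X X' t)
    (hq : (u t, v t) ∈ liftDomain φ U D)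
    (hn : ∀ᶠ s in nhds t, IsNormalVec L φ (u s, v s) (X s)) (c : Vec m) :
    d2 (energy L) (lift φ (u t, v t)) (vert (fderiv ℝ φ (u t) c))
        (vert (X' + (hConnVec L (lift φ (u t, v t)) (X t) (fderiv ℝ φ (u t) u')
          + cartanVec L (lift φ (u t, v t)) (X t)
            (dirVec L φ (u t, v t) u' + fderiv ℝ φ (u t) v'))))
      + d2 (energy L) (lift φ (u t, v t)) (vert (fderiv ℝ (fderiv ℝ φ) (u t) c u'
          + hConnVec L (lift φ (u t, v t)) (fderiv ℝ φ (u t) c) (fderiv ℝ φ (u t) u')))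
          (vert (X t))
      + (1 / 2) * d3 (energy L) (lift φ (u t, v t)) (vert (fderiv ℝ φ (u t) c))
          (vert (dirVec L φ (u t, v t) u' + fderiv ℝ φ (u t) v')) (vert (X t)) = 0 := by
  have hB := vert.hasFDerivAt.comp_hasDerivAt t
    (hφ.hasDerivAt_fderiv_apply (v := fun _ => c) hq.1 hu (hasDerivAt_const t c))
  have h := hasDerivAt_d2_apply hL.isOpen hL.contDiffOn_energy hq.2
    (hφ.hasDerivAt_lift hq.1 hu hv) hB (vert.hasFDerivAt.comp_hasDerivAt t hX)
  have h0 := h.unique ((hasDerivAt_const t (0 : ℝ)).congr_of_eventuallyEq (hn.mono fun s hs => hs c))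
  have e := dirVec_eq_of_curve L φ (u t, v t) u' v'
  simp only [Function.comp_apply] at h0
  rw [hL.d3_eq_covariant hq.2, e, map_zero, add_zero,
    hφ.fderiv_fderiv_symm hq.1] at h0
  have hC := hL.cartanVec_eq hq.2 (fderiv ℝ φ (u t) c)
    (dirVec L φ (u t, v t) u' + fderiv ℝ φ (u t) v') (X t)
  simp only [map_add, add_apply] at h0 hC ⊢
  linarith

/-- The normal part of the covariant derivative of a unit field along a curve of line elements. -/
theorem d2_covariant_unit {u v : ℝ → Vec m} {X : ℝ → Vec n} {u' v' : Vec m} {X' : Vec n} {t : ℝ}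
    (hu : HasDerivAt u u' t) (hv : HasDerivAt v v' t) (hX : HasDerivAt X X' t)
    (hq : (u t, v t) ∈ liftDomain φ U D)
    (hn : ∀ᶠ s in nhds t, d2 (energy L) (lift φ (u s, v s)) (vert (X s)) (vert (X s)) = 1) :
    d2 (energy L) (lift φ (u t, v t)) (vert (X t))
        (vert (X' + (hConnVec L (lift φ (u t, v t)) (X t) (fderiv ℝ φ (u t) u')
          + cartanVec L (lift φ (u t, v t)) (X t)
            (dirVec L φ (u t, v t) u' + fderiv ℝ φ (u t) v')))) = 0 := by
  have hXv := vert.hasFDerivAt.comp_hasDerivAt t hX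
  have h := hasDerivAt_d2_apply hL.isOpen hL.contDiffOn_energy hq.2
    (hφ.hasDerivAt_lift hq.1 hu hv) hXv hXv
  have h0 := h.unique ((hasDerivAt_const t (1 : ℝ)).congr_of_eventuallyEq hn)
  simp only [Function.comp_apply] at h0
  rw [hL.d3_eq_covariant hq.2, dirVec_eq_of_curve L φ (u t, v t) u' v',
    d2_comm hL.isOpen hL.contDiffOn_energy hq.2 _ (vert (X t)),
    d2_comm hL.isOpen hL.contDiffOn_energy hq.2 (vert X') _] at h0
  simp only [map_add] at h0 ⊢
  linarith

/-- Along a hypersurface, a vector that is orthogonal to the tangent space and to a unit normal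
vector vanishes. -/
theorem eq_zero_of_orthogonal (hn : n = m + 1) {q : Vec m × Vec m} (hq : q ∈ liftDomain φ U D)
    {X W : Vec n} (hX : IsUnitNormal L φ q X) (hW : IsNormalVec L φ q W)
    (hXW : d2 (energy L) (lift φ q) (vert X) (vert W) = 0) : W = 0 := by
  rw [isUnitNormal_iff hL hq] at hX
  -- The tangent space plus the normal line fills the ambient space, by injectivity and equality of
  -- dimensions.
  let T : (Vec m × ℝ) →ₗ[ℝ] Vec n :=
    (fderiv ℝ φ q.1 : Vec m →ₗ[ℝ] Vec n).coprod (LinearMap.toSpanSingleton ℝ _ X)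
  have hT : ∀ a s, T (a, s) = fderiv ℝ φ q.1 a + s • X := fun a s => by simp [T]
  have hinj : Function.Injective T := by
    rw [injective_iff_map_eq_zero]
    rintro ⟨a, s⟩ h
    rw [hT] at h
    have h1 : d2 (energy L) (lift φ q) (vert (fderiv ℝ φ q.1 a + s • X)) (vert X) = 0 := by
      rw [h, map_zero, map_zero, zero_apply]
    simp only [map_add, map_smul, add_apply, smul_apply, smul_eq_mul, hX.1 a, hX.2] at h1
    have hs : s = 0 := by linarith
    rw [hs, zero_smul, add_zero] at h
    rw [hs, hφ.injective q.1 hq.1 (h.trans (map_zero _).symm)]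
    rfl
  have hsurj : Function.Surjective T :=
    (LinearMap.injective_iff_surjective_of_finrank_eq_finrank (by simp [hn])).1 hinj
  obtain ⟨⟨a, s⟩, h⟩ := hsurj W
  refine hL.eq_zero_of_d2_vert_self hq.2 ?_
  have h1 : d2 (energy L) (lift φ q) (vert (fderiv ℝ φ q.1 a + s • X)) (vert W) = 0 := by
    simp only [map_add, map_smul, add_apply, smul_apply, smul_eq_mul, hW a, hXW, mul_zero, add_zero]
  rwa [← hT, h] at h1

/-- The tangential part of the covariant derivative of the normal is governed by the second
fundamental `h`-tensor and by `M_αβ`, both zero. The normal part vanishes because the length is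
constant, and codimension one leaves no further component. -/
theorem isThirdKindOn_of_isFlatOn (hn : n = m + 1) (hflat : IsFlatOn D L φ U) :
    IsThirdKindOn D L φ U := by
  intro a b u v X hu hv hX hQ t ht i
  have hmem := isOpen_Ioo.mem_nhds ht
  have diff : ∀ {k : ℕ} {f : ℝ → Vec k}, ContDiffOn ℝ ∞ f (Set.Ioo a b) →
      HasDerivAt f (deriv f t) t := fun hf =>
    ((hf.contDiffAt hmem).differentiableAt (by simp)).hasDerivAt
  have hq := (hQ t ht).1
  have hN := (hQ t ht).2
  have hx := hφ.hasDerivAt_comp hq.1 (diff hu)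
  have hy := hφ.hasDerivAt_fderiv_apply hq.1 (diff hu) (diff hv)
  have hcov := hL.covDerivAlong_eq (x := fun s => (lift φ (u s, v s)).1)
    (y := fun s => (lift φ (u s, v s)).2) hq.2 hx hy (diff hX) i
  rw [hcov]
  change (_ + (_ + cartanVec L (lift φ (u t, v t)) _ (fderiv ℝ (fderiv ℝ φ) (u t) _ _ + _
    + nonlinMap L (lift φ (u t, v t)) _))) i = 0
  have e := dirVec_eq_of_curve L φ (u t, v t) (deriv u t) (deriv v t)
  dsimp only at e
  rw [e]
  refine congrFun (hφ.eq_zero_of_orthogonal hL hn hq hN (fun c => ?_) ?_) i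
  · have h := hφ.d2_covariant_normal hL (diff hu) (diff hv) (diff hX) hq
      (Filter.mem_of_superset hmem fun s hs => ((isUnitNormal_iff hL (hQ s hs).1 _).1
        (hQ s hs).2).1) c
    obtain ⟨c1, hc1⟩ := hflat.dirVec_tangent _ hq (deriv u t)
    obtain ⟨c2, hc2⟩ := hφ.second_fundamental_tangent hL hq hflat c (deriv u t)
    have hNn := ((isUnitNormal_iff hL hq _).1 hN).1
    have h2 := hNn c2
    have h3 := hflat.cartan_eq_zero _ hq _ hNn c (c1 + deriv v t)
    rw [map_add, hc1] at h3
    rw [hc2] at h2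
    rw [h2, h3] at h
    linarith
  · exact hφ.d2_covariant_unit hL (diff hu) (diff hv) (diff hX) hq
      (Filter.mem_of_superset hmem fun s hs => ((isUnitNormal_iff hL (hQ s hs).1 _).1
        (hQ s hs).2).2)

/-- A unit normal vector extends to a smooth unit normal field along a short line. -/
theorem exists_unit_normal_line {q : Vec m × Vec m} (hq : q ∈ liftDomain φ U D) {X : Vec n}
    (hX : IsUnitNormal L φ q X) (w : Vec m × Vec m) :
    ∃ (ε : ℝ) (Y : ℝ → Vec n), 0 < ε ∧ Y 0 = X ∧ ContDiffOn ℝ ∞ Y (Set.Ioo (-ε) ε) ∧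
      ∀ s ∈ Set.Ioo (-ε) ε, q + s • w ∈ liftDomain φ U D ∧ IsUnitNormal L φ (q + s • w) (Y s) := by
  have hQ := hφ.isOpen_liftDomain hL.isOpen
  set Y0 : Vec m × Vec m → Vec n := fun r => X - fderiv ℝ φ r.1 (projVec L φ r X) with hY0
  have hY0s : ContDiffOn ℝ ∞ Y0 (liftDomain φ U D) := hφ.contDiffOn_sub_projVec hL X
  have hX' := (isUnitNormal_iff hL hq _).1 hX
  have hY0q : Y0 q = X := by
    have : projVec L φ q X = 0 :=
      hφ.projVec_eq_of_isNormalVec hL hq (by rw [map_zero, sub_zero]; exact hX'.1)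
    simp [hY0, this]
  set g : Vec m × Vec m → ℝ := fun r => d2 (energy L) (lift φ r) (vert (Y0 r)) (vert (Y0 r))
  have hv : ContDiffOn ℝ ∞ (fun r => vert (Y0 r)) (liftDomain φ U D) :=
    vert.contDiff.comp_contDiffOn hY0s
  have hg : ContDiffOn ℝ ∞ g (liftDomain φ U D) :=
    (((contDiffOn_d2 hL.isOpen hL.contDiffOn_energy).comp
      (hφ.contDiffOn_lift_liftDomain D) fun _ h => h.2).clm_apply hv).clm_apply hv
  have hline : ContDiff ℝ ∞ (fun s : ℝ => q + s • w) := by fun_prop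
  -- Restricting to `g > 0` keeps the normalizing square root smooth.
  have hO : IsOpen ((fun s : ℝ => q + s • w) ⁻¹' (liftDomain φ U D ∩ g ⁻¹' Set.Ioi 0)) :=
    (hg.continuousOn.isOpen_inter_preimage hQ isOpen_Ioi).preimage hline.continuous
  have h0 : (0 : ℝ) ∈ (fun s : ℝ => q + s • w) ⁻¹' (liftDomain φ U D ∩ g ⁻¹' Set.Ioi 0) := by
    have : 0 < g q := by simp [g, hY0q, hX'.2]
    simpa using ⟨hq, this⟩
  obtain ⟨ε, hε, hball⟩ := Metric.isOpen_iff.1 hO 0 h0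
  rw [Real.ball_eq_Ioo, zero_sub, zero_add] at hball
  refine ⟨ε, fun s => (Real.sqrt (g (q + s • w)))⁻¹ • Y0 (q + s • w), hε, ?_, ?_, fun s hs => ?_⟩
  · simp [g, hY0q, hX'.2]
  · have hl := hline.contDiffOn (s := Set.Ioo (-ε) ε)
    exact ContDiffOn.smul (ContDiffOn.inv (ContDiffOn.sqrt (hg.comp hl fun s hs => (hball hs).1)
      fun s hs => (hball hs).2.ne') fun s hs => (Real.sqrt_pos.2 (hball hs).2).ne')
      (hY0s.comp hl fun s hs => (hball hs).1)
  · have hs' := (hball hs).1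
    have hpos : 0 < g (q + s • w) := (hball hs).2
    refine ⟨hs', isUnitNormal_smul hL hs' (hφ.isNormalVec_sub_projVec hL hs' X) fun h => ?_⟩
    have : Y0 (q + s • w) = 0 := h
    simp [g, this] at hpos

/-- Parallelism is tested on the line of line elements through `q` with velocity `(a, c)`. The first
term of `d2_covariant_normal` is then zero. -/
theorem second_fundamental_of_isThirdKindOn (h3 : IsThirdKindOn D L φ U) {q : Vec m × Vec m}
    (hq : q ∈ liftDomain φ U D) {X : Vec n} (hX : IsUnitNormal L φ q X) (a b c : Vec m) :
    d2 (energy L) (lift φ q) (vert (fderiv ℝ (fderiv ℝ φ) q.1 b a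
        + hConnVec L (lift φ q) (fderiv ℝ φ q.1 b) (fderiv ℝ φ q.1 a))) (vert X)
      + (1 / 2) * d3 (energy L) (lift φ q) (vert (fderiv ℝ φ q.1 b))
          (vert (dirVec L φ q a + fderiv ℝ φ q.1 c)) (vert X) = 0 := by
  obtain ⟨ε, Y, hε, hY0, hYs, hY⟩ := hφ.exists_unit_normal_line hL hq hX (a, c)
  have h0 : (0 : ℝ) ∈ Set.Ioo (-ε) ε := ⟨by linarith, hε⟩
  have hmem := isOpen_Ioo.mem_nhds h0
  have hl := hasDerivAt_line q (a, c)
  have hu : HasDerivAt (fun s : ℝ => q.1 + s • a) a 0 := hl.fst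
  have hv : HasDerivAt (fun s : ℝ => q.2 + s • c) c 0 := hl.snd
  have hYd : HasDerivAt Y (deriv Y 0) 0 :=
    ((hYs.contDiffAt hmem).differentiableAt (by simp)).hasDerivAt
  have hq0 : (q.1 + (0 : ℝ) • a, q.2 + (0 : ℝ) • c) ∈ liftDomain φ U D := (hY 0 h0).1
  have hq0' : q.1 + (0 : ℝ) • a ∈ U := hq0.1
  have hpar := h3 (-ε) ε (fun s => q.1 + s • a) (fun s => q.2 + s • c) Y
    (by fun_prop) (by fun_prop) hYs hY 0 h0
  have hx := hφ.hasDerivAt_comp hq0' hu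
  have hy := hφ.hasDerivAt_fderiv_apply hq0' hu hv
  have hcov : deriv Y 0 + (hConnVec L (lift φ q) (Y 0) (fderiv ℝ φ q.1 a)
      + cartanVec L (lift φ q) (Y 0) (dirVec L φ q a + fderiv ℝ φ q.1 c)) = 0 := by
    ext i
    rw [← dirVec_eq_of_curve L φ q]
    have h := hL.covDerivAlong_eq (x := fun s : ℝ => (lift φ (q.1 + s • a, q.2 + s • c)).1)
      (y := fun s : ℝ => (lift φ (q.1 + s • a, q.2 + s • c)).2) hq0.2 hx hy hYd i
    rw [hpar i] at h
    simp only [zero_smul, add_zero] at h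
    exact h.symm
  have h := hφ.d2_covariant_normal hL hu hv hYd hq0
    (Filter.mem_of_superset hmem fun s hs => ((isUnitNormal_iff hL (hY s hs).1 _).1
        (hY s hs).2).1) b
  simp only [zero_smul, add_zero, Prod.mk.eta] at h
  rw [hcov, hY0, map_zero, map_zero, zero_add] at h
  exact h

/-- Different test curves and test vectors isolate the two tensors: pairing with the supporting
element yields `H_β`, and moving only the supporting element yields `M_αβ`. -/
theorem isFlatOn_of_isThirdKindOn (h3 : IsThirdKindOn D L φ U) : IsFlatOn D L φ U := by
  constructor
  · intro q hq a
    refine hφ.exists_fderiv_eq_of_normal hL hq fun X hX => ?_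
    refine normal_induction hL hq
      (T := ((d2 (energy L) (lift φ q) (vert (dirVec L φ q a))).comp vert).toLinearMap)
      (fun X hX => ?_) hX
    -- For the test vector `v`, `F^i_0k = N^i_k` turns the `h`-tensor into `H_β`, and the Cartan
    -- term dies by `C_ij0 = 0`.
    have h := hφ.second_fundamental_of_isThirdKindOn hL h3 hq hX a q.2 0
    have e : (lift φ q).2 = fderiv ℝ φ q.1 q.2 := rfl
    have hF := hL.hConnVec_self hq.2 (fderiv ℝ φ q.1 a)
    have h0 := hL.d3_vert_vert_self hq.2 (dirVec L φ q a + fderiv ℝ φ q.1 0) X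
    rw [d3_comm_right hL.isOpen hL.contDiffOn_energy hq.2,
      d3_comm_left hL.isOpen hL.contDiffOn_energy hq.2] at h0
    rw [e] at h0 hF
    rw [h0, hF, hφ.fderiv_fderiv_symm hq.1] at h
    change d2 (energy L) (lift φ q) (vert (dirVec L φ q a)) (vert X) = 0
    rw [dirVec]
    linarith
  · intro q hq X hX a b
    refine normal_induction hL hq
      (T := ((d3 (energy L) (lift φ q) (vert (fderiv ℝ φ q.1 a))
        (vert (fderiv ℝ φ q.1 b))).comp vert).toLinearMap) (fun X hX => ?_) hX
    -- The position is constant. Subtracting the same identity with zero velocity leaves only the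
    -- Cartan term in the direction `b`.
    have h := hφ.second_fundamental_of_isThirdKindOn hL h3 hq hX 0 a b
    have h' := hφ.second_fundamental_of_isThirdKindOn hL h3 hq hX 0 a 0
    change d3 (energy L) (lift φ q) (vert (fderiv ℝ φ q.1 a)) (vert (fderiv ℝ φ q.1 b))
      (vert X) = 0
    simp only [map_add, map_zero, add_zero, add_apply] at h h'
    linarith

end IsImmersionOn


/-! ### Existence of `h`-paths and hyperplanes of the second kind. -/

variable {m n : ℕ}

/-- An `h`-path with given initial position, supporting element and velocity exists for smooth
coefficients. -/
theorem exists_isHPath {N : Fin n → Fin n → Vec n × Vec n → ℝ}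
    {F : Fin n → Fin n → Fin n → Vec n × Vec n → ℝ} {D : Set (Vec n × Vec n)} (hD : IsOpen D)
    (hN : ∀ i j, ContDiffOn ℝ ∞ (N i j) D) (hF : ∀ i j k, ContDiffOn ℝ ∞ (F i j k) D)
    {p : Vec n × Vec n} (hp : p ∈ D) (w₀ : Vec n) :
    ∃ ε > (0 : ℝ), ∃ x y : ℝ → Vec n, IsHPath N F D (-ε) ε x y ∧ (x 0, y 0) = p ∧
      HasDerivAt x w₀ 0 := by
  -- The path equations as an autonomous first-order system for position, supporting element and
  -- velocity.
  let V : (Vec n × Vec n) × Vec n → (Vec n × Vec n) × Vec n := fun z =>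
    ((z.2, fun i => -∑ j, N i j z.1 * z.2 j),
      fun i => -∑ j, ∑ k, F i j k z.1 * z.2 j * z.2 k)
  have hz : ∀ j, ContDiffOn ℝ ∞ (fun z : (Vec n × Vec n) × Vec n => z.2 j) {z | z.1 ∈ D} :=
    fun j => ((contDiff_apply ℝ ℝ j).comp contDiff_snd).contDiffOn
  have hV : ContDiffOn ℝ ∞ V {z | z.1 ∈ D} := by
    refine (contDiffOn_snd.prodMk (contDiffOn_pi.2 fun i => ?_)).prodMk
      (contDiffOn_pi.2 fun i => ?_)
    · exact (ContDiffOn.sum fun j _ => ((hN i j).comp contDiffOn_fst fun _ h => h).mul (hz j)).neg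
    · exact (ContDiffOn.sum fun j _ => ContDiffOn.sum fun k _ =>
        (((hF i j k).comp contDiffOn_fst fun _ h => h).mul (hz j)).mul (hz k)).neg
  have hO : IsOpen {z : (Vec n × Vec n) × Vec n | z.1 ∈ D} := hD.preimage continuous_fst
  have hV0 : ContDiffAt ℝ 1 V (p, w₀) :=
    (hV.contDiffAt (hO.mem_nhds (show (p, w₀) ∈ {z : (Vec n × Vec n) × Vec n | z.1 ∈ D} from hp))
      ).of_le (by simp)
  obtain ⟨α, hα0, ε, hε, hα⟩ :=
    hV0.exists_forall_mem_closedBall_exists_eq_forall_mem_Ioo_hasDerivAt₀ 0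
  have hα0' := hα 0 ⟨by linarith, by linarith⟩
  -- The solution may leave `D`, so the time interval is shortened.
  have hev : ∀ᶠ t in nhds (0 : ℝ), (α t).1 ∈ D := by
    refine hα0'.continuousAt.preimage_mem_nhds (hO.mem_nhds ?_)
    rw [hα0]; exact hp
  obtain ⟨δ, hδ, hball⟩ := Metric.eventually_nhds_iff_ball.1 hev
  rw [Real.ball_eq_Ioo, zero_sub, zero_add] at hball
  refine ⟨min ε δ, lt_min hε hδ, fun t => (α t).1.1, fun t => (α t).1.2,
    ⟨fun t => (α t).2, fun t ht => ?_⟩, by rw [Prod.mk.eta, hα0], ?_⟩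
  · have h1 := hα t ⟨by linarith [ht.1, min_le_left ε δ], by linarith [ht.2, min_le_left ε δ]⟩
    exact ⟨hball t ⟨by linarith [ht.1, min_le_right ε δ], by linarith [ht.2, min_le_right ε δ]⟩,
      h1.fst.fst, h1.fst.snd, h1.snd⟩
  · have := hα0'.fst.fst
    rw [hα0] at this
    exact this

namespace IsImmersionOn

variable {φ : Vec m → Vec n} {U : Set (Vec m)} (hφ : IsImmersionOn φ U)
  {D : Set (Vec n × Vec n)} {L : Vec n × Vec n → ℝ} (hL : IsFinslerOn D L)

include hφ hL

/-- Run an induced `h`-path through `q` with velocity `a`. Its lifted supporting element has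
derivative `B_0 a + B v'` by the chain rule and `-N(B a)` by the ambient equation, so `B_0 a + N(B
a) = -B v'` is tangential. -/
theorem dirVec_tangent_of_isSecondKindOn (h2 : IsSecondKindOn D L φ U) {q : Vec m × Vec m}
    (hq : q ∈ liftDomain φ U D) (a : Vec m) : ∃ c, fderiv ℝ φ q.1 c = dirVec L φ q a := by
  obtain ⟨ε, hε, u, v, hpath, h0, hu⟩ := exists_isHPath (hφ.isOpen_liftDomain hL.isOpen)
    (hφ.contDiffOn_inducedNonlin hL) (hφ.contDiffOn_inducedHConn hL) hq a
  obtain ⟨w', hamb⟩ := h2 _ _ u v hpath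
  have hmem : (0 : ℝ) ∈ Set.Ioo (-ε) ε := ⟨by linarith, hε⟩
  obtain ⟨w, hw⟩ := hpath
  obtain ⟨hq0, -, hv, -⟩ := hw 0 hmem
  obtain ⟨hp0, hx, hy, -⟩ := hamb 0 hmem
  have hx' := hx.unique (hφ.hasDerivAt_comp hq0.1 hu)
  have hy' := hy.unique (hφ.hasDerivAt_fderiv_apply hq0.1 hu hv)
  have hq' : q = (u 0, v 0) := h0.symm
  have hN : nonlinMap L (lift φ q) (fderiv ℝ φ q.1 a) =
      fun i => ∑ j, nonlin L i j (lift φ q) * fderiv ℝ φ q.1 a j :=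
    funext fun i => hL.nonlinMap_apply hq.2 _ i
  rw [hx'] at hy'
  subst hq'
  refine ⟨-(fun i => -∑ j, inducedNonlin L φ i j (u 0, v 0) * w 0 j), ?_⟩
  rw [map_neg, dirVec, hN]
  ext i
  have := congrFun hy' i
  simp only [Pi.add_apply, Pi.neg_apply] at this ⊢
  change -∑ j, nonlin L i j (lift φ (u 0, v 0)) * fderiv ℝ φ (u 0) a j = _ at this
  linarith

omit hφ hL in
theorem dirVec_eq_sum (L : Vec n × Vec n → ℝ) (φ : Vec m → Vec n) (q : Vec m × Vec m) (a : Vec m) :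
    dirVec L φ q a = ∑ β, a β • dirVec L φ q (Pi.single β 1) := by
  conv_lhs => rw [vec_eq_sum a]
  simp only [dirVec, map_sum, map_smul, sum_apply, smul_apply, smul_add, Finset.sum_add_distrib]

theorem sum_inducedNonlin {q : Vec m × Vec m} (hq : q ∈ liftDomain φ U D) (a : Vec m)
    (α : Fin m) : ∑ β, inducedNonlin L φ α β q * a β = projVec L φ q (dirVec L φ q a) α := by
  simp only [inducedNonlin, projVec, hφ.dirDeriv_eq hL hq]
  rw [dirVec_eq_sum L φ q a]
  simp only [Finset.sum_apply, Pi.smul_apply, smul_eq_mul, Finset.mul_sum, Finset.sum_mul]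
  rw [Finset.sum_comm]
  exact Finset.sum_congr rfl fun i _ => Finset.sum_congr rfl fun β _ => by ring

theorem sum_inducedHConn (hflat : IsFlatOn D L φ U) {q : Vec m × Vec m}
    (hq : q ∈ liftDomain φ U D) (a : Vec m) (α : Fin m) :
    ∑ β, ∑ γ, inducedHConn L φ α β γ q * a β * a γ =
      projVec L φ q (fderiv ℝ (fderiv ℝ φ) q.1 a a
        + hConnVec L (lift φ q) (fderiv ℝ φ q.1 a) (fderiv ℝ φ q.1 a)) α := by
  -- Flatness removes the `M^α_β H_γ` part of the induced connection.
  have hn : ∀ k γ, normalCurv L φ k γ q = 0 := fun k γ => by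
    rw [hφ.normalCurv_eq hL hq, (hφ.exists_fderiv_eq_iff hL hq _).1
      (hflat.dirVec_tangent q hq _), sub_self, Pi.zero_apply]
  have e1 : ∀ i, fderiv ℝ (fderiv ℝ φ) q.1 a a i = ∑ β, ∑ γ, proj2 φ i β γ q.1 * a β * a γ := by
    intro i
    have h1 : ∀ b, fderiv ℝ (fderiv ℝ φ) q.1 a b =
        ∑ γ, a γ • fderiv ℝ (fderiv ℝ φ) q.1 (Pi.single γ 1) b := fun b => by
      conv_lhs => rw [vec_eq_sum a]
      simp only [map_sum, map_smul, sum_apply, smul_apply]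
    have h2 : ∀ A : Vec m →L[ℝ] Vec n, A a = ∑ β, a β • A (Pi.single β 1) := fun A => by
      conv_lhs => rw [vec_eq_sum a]
      simp only [map_sum, map_smul]
    rw [h1]
    simp only [h2, Finset.sum_apply, Pi.smul_apply, smul_eq_mul,
      hφ.proj2_eq hq.1, Finset.mul_sum]
    rw [Finset.sum_comm]
    refine Finset.sum_congr rfl fun β _ => Finset.sum_congr rfl fun γ _ => ?_
    ring
  have e2 : ∀ j, fderiv ℝ φ q.1 a j = ∑ β, proj φ j β q.1 * a β := by
    intro j
    conv_lhs => rw [vec_eq_sum a]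
    simp only [map_sum, map_smul, Finset.sum_apply, Pi.smul_apply, smul_eq_mul, proj]
    exact Finset.sum_congr rfl fun β _ => by ring
  have e3 : ∀ i, hConnVec L (lift φ q) (fderiv ℝ φ q.1 a) (fderiv ℝ φ q.1 a) i =
      ∑ β, ∑ γ, (∑ j, ∑ k, hConn L i j k (lift φ q) * proj φ j β q.1 * proj φ k γ q.1)
        * a β * a γ := by
    intro i
    simp only [hConnVec, e2, mul_assoc, Finset.sum_mul, Finset.mul_sum]
    calc _ = ∑ j, ∑ k, ∑ β, ∑ γ, _ := Finset.sum_congr rfl fun j _ =>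
          Finset.sum_congr rfl fun k _ => Finset.sum_comm
      _ = ∑ j, ∑ β, ∑ k, ∑ γ, _ := Finset.sum_congr rfl fun j _ => Finset.sum_comm
      _ = ∑ β, ∑ j, ∑ k, ∑ γ, _ := Finset.sum_comm
      _ = ∑ β, ∑ j, ∑ γ, ∑ k, _ := Finset.sum_congr rfl fun β _ => Finset.sum_congr rfl fun j _ =>
        Finset.sum_comm
      _ = ∑ β, ∑ γ, ∑ j, ∑ k, _ := Finset.sum_congr rfl fun β _ => Finset.sum_comm
      _ = _ := Finset.sum_congr rfl fun β _ => Finset.sum_congr rfl fun γ _ =>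
        Finset.sum_congr rfl fun j _ => Finset.sum_congr rfl fun k _ => by ring
  simp only [inducedHConn, hn, mul_zero, Finset.sum_const_zero, add_zero, projVec, Pi.add_apply,
    e1, e3, ← Finset.sum_add_distrib, ← add_mul]
  simp only [Finset.mul_sum, Finset.sum_mul]
  calc _ = ∑ β, ∑ i, ∑ γ, _ := Finset.sum_congr rfl fun β _ => Finset.sum_comm
    _ = ∑ i, ∑ β, ∑ γ, _ := Finset.sum_comm
    _ = _ := Finset.sum_congr rfl fun i _ => Finset.sum_congr rfl fun β _ =>
      Finset.sum_congr rfl fun γ _ => by ring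

/-- The induced equations are projections of ambient expressions. Those expressions are already
tangential here, so nothing is lost and the path equations push forward. -/
theorem isSecondKindOn_of_isFlatOn (hflat : IsFlatOn D L φ U) : IsSecondKindOn D L φ U := by
  rintro a b u v ⟨w, hw⟩
  refine ⟨fun t => fderiv ℝ φ (u t) (w t), fun t ht => ?_⟩
  obtain ⟨hq, hu, hv, hwd⟩ := hw t ht
  refine ⟨hq.2, hφ.hasDerivAt_comp hq.1 hu, ?_, ?_⟩
  · refine (hφ.hasDerivAt_fderiv_apply hq.1 hu hv).congr_deriv ?_
    have e : (fun α => -∑ β, inducedNonlin L φ α β (u t, v t) * w t β) =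
        -projVec L φ (u t, v t) (dirVec L φ (u t, v t) (w t)) :=
      funext fun α => by rw [hφ.sum_inducedNonlin hL hq, Pi.neg_apply]
    have h := (hφ.exists_fderiv_eq_iff hL hq _).1 (hflat.dirVec_tangent _ hq (w t))
    dsimp only at h
    rw [e, map_neg, h, dirVec]
    ext i
    have := hL.nonlinMap_apply hq.2 (fderiv ℝ φ (u t) (w t)) i
    simp only [Pi.add_apply, Pi.neg_apply, this]
    change _ = -∑ j, nonlin L i j (lift φ (u t, v t)) * _
    ring
  · refine (hφ.hasDerivAt_fderiv_apply hq.1 hu hwd).congr_deriv ?_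
    have e : (fun α => -∑ β, ∑ γ, inducedHConn L φ α β γ (u t, v t) * w t β * w t γ) =
        -projVec L φ (u t, v t) (fderiv ℝ (fderiv ℝ φ) (u t) (w t) (w t)
        + hConnVec L (lift φ (u t, v t)) (fderiv ℝ φ (u t) (w t)) (fderiv ℝ φ (u t) (w t))) :=
      funext fun α => by rw [hφ.sum_inducedHConn hL hflat hq, Pi.neg_apply]
    have h := (hφ.exists_fderiv_eq_iff hL hq _).1
      (hφ.second_fundamental_tangent hL hq hflat (w t) (w t))
    dsimp only at h
    rw [e, map_neg, h]
    ext i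
    simp only [Pi.add_apply, Pi.neg_apply, hConnVec]
    change _ = -∑ j, ∑ k, hConn L i j k (lift φ (u t, v t)) * _ * _
    ring

theorem isFlatOn_of_isSecondKindOn (h2 : IsSecondKindOn D L φ U)
    (hM : SecondVTensorVanishesOn L φ (liftDomain φ U D)) : IsFlatOn D L φ U := by
  refine ⟨fun q hq a => hφ.dirVec_tangent_of_isSecondKindOn hL h2 hq a, fun q hq X hX a b => ?_⟩
  refine normal_induction hL hq
    (T := ((d3 (energy L) (lift φ q) (vert (fderiv ℝ φ q.1 a))
      (vert (fderiv ℝ φ q.1 b))).comp vert).toLinearMap) (fun X hX => ?_) hX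
  change d3 (energy L) (lift φ q) (vert (fderiv ℝ φ q.1 a)) (vert (fderiv ℝ φ q.1 b))
    (vert X) = 0
  have h0 : ∀ α β : Fin m, d3 (energy L) (lift φ q) (vert (fderiv ℝ φ q.1 (Pi.single α 1)))
      (vert (fderiv ℝ φ q.1 (Pi.single β 1))) (vert X) = 0 := fun α β => by
    rw [hL.d3_vert_eq_sum hq.2]
    exact mul_eq_zero_of_right _ (hM q hq X hX α β)
  rw [vec_eq_sum a, vec_eq_sum b]
  simp [map_sum, sum_apply, h0]

end IsImmersionOn


/-! ## The `h`-exponential change -/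

section Change

variable {m n : ℕ}

/-- The function `β = b_i y^i`. -/
def betaFun (b : Fin n → Vec n × Vec n → ℝ) (p : Vec n × Vec n) : ℝ := ∑ i, b i p * p.2 i

/-- The angular metric multiplied by `L²`. -/
def angularForm (L : Vec n × Vec n → ℝ) (p : Vec n × Vec n) (X Y : Vec n) : ℝ :=
  2 * energy L p * d2 (energy L) p (vert X) (vert Y)
    - fderiv ℝ (energy L) p (vert X) * fderiv ℝ (energy L) p (vert Y)

/-- The coefficient of `dE` in the differential of the energy of `L e^{β/L}`. -/
def changeP (L β : Vec n × Vec n → ℝ) (p : Vec n × Vec n) : ℝ :=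
  Real.exp (2 * (β p / L p)) * (1 - β p / L p)

/-- The coefficient of `dβ` in the differential of the energy of `L e^{β/L}`. -/
def changeR (L β : Vec n × Vec n → ℝ) (p : Vec n × Vec n) : ℝ :=
  L p * Real.exp (2 * (β p / L p))

variable {D : Set (Vec n × Vec n)} {L L' : Vec n × Vec n → ℝ} {b : Fin n → Vec n × Vec n → ℝ}
  (hL : IsFinslerOn D L)

namespace IsFinslerOn

include hL

theorem fderiv_energy {p : Vec n × Vec n} (hp : p ∈ D) (w : Vec n × Vec n) :
    fderiv ℝ (energy L) p w = L p * fderiv ℝ L p w := by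
  have h := hasFDerivAt_of_contDiffOn hL.isOpen hL.smooth hp
  have h2 : HasFDerivAt (energy L) _ p := (h.pow 2).const_mul (1 / 2)
  rw [h2.fderiv]
  simp only [smul_apply, smul_eq_mul]
  norm_num
  ring

/-- From `L² = 2E` and `L l_i = ∂̇_i E`. The form `angularForm` avoids denominators and derivatives
of `L`. -/
theorem angular_eq {p : Vec n × Vec n} (hp : p ∈ D) (i j : Fin n) :
    angular L i j p = angularForm L p (Pi.single i 1) (Pi.single j 1) / L p ^ 2 := by
  have h0 := (hL.pos p hp).ne'
  rw [angular, angularForm, hL.metric_eq hp, hL.fderiv_energy hp, hL.fderiv_energy hp, dy, dy,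
    energy]
  simp only [vert_apply]
  field_simp

theorem angularForm_self {p : Vec n × Vec n} (hp : p ∈ D) (X : Vec n) :
    angularForm L p X p.2 = 0 := by
  rw [angularForm, hL.d2_vert_vert_self hp, hL.fderiv_energy_vert_self hp]; ring

theorem angularForm_comm {p : Vec n × Vec n} (hp : p ∈ D) (X Y : Vec n) :
    angularForm L p X Y = angularForm L p Y X := by
  rw [angularForm, angularForm, d2_comm hL.isOpen hL.contDiffOn_energy hp]; ring

omit hL in
theorem angularForm_eq_sum (L : Vec n × Vec n → ℝ) (p : Vec n × Vec n) (X Y : Vec n) :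
    angularForm L p X Y = ∑ i, X i * angularForm L p (Pi.single i 1) Y := by
  simp only [angularForm]
  conv_lhs => rw [vert_eq_sum X]
  simp only [map_sum, map_smul, sum_apply, smul_apply, smul_eq_mul, Finset.mul_sum,
    Finset.sum_mul, ← Finset.sum_sub_distrib]
  exact Finset.sum_congr rfl fun i _ => by ring

end IsFinslerOn

/-! ### Derivatives of an `h`-vector and of `β`. -/

namespace IsHVectorOn

variable (hb : IsHVectorOn D L b)

include hb

theorem contDiffOn_betaFun : ContDiffOn ℝ ∞ (betaFun b) D :=
  ContDiffOn.sum fun i _ => (hb.smooth i).mul (IsFinslerOn.contDiff_snd_apply i).contDiffOn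

include hL

/-- The vertical derivatives of an `h`-vector are proportional to the angular metric. -/
theorem exists_fderiv_vert : ∃ κ : Vec n × Vec n → ℝ, ∀ p ∈ D, ∀ i Z,
    fderiv ℝ (b i) p (vert Z) = κ p * angularForm L p (Pi.single i 1) Z := by
  obtain ⟨ρ, hρ⟩ := hb.exists_rho
  -- The two conditions give `∂̇_k b_i = ρ h_ik / L`, and `h_ik` is `angularForm` divided by `L²`.
  refine ⟨fun p => ρ p / L p ^ 3, fun p hp i Z => ?_⟩
  have h0 := (hL.pos p hp).ne'
  have h1 : ∀ k, fderiv ℝ (b i) p (vert (Pi.single k 1)) =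
      ρ p / L p ^ 3 * angularForm L p (Pi.single i 1) (Pi.single k 1) := fun k => by
    have h2 := hb.vCov_eq_zero p hp i k
    have h3 := hρ p hp i k
    rw [vCov, sub_eq_zero] at h2
    rw [hL.angular_eq hp] at h3
    change dy k (b i) p = _
    rw [h2]
    have h4 : ∑ r, b r p * cartanUp L r i k p = ∑ h, cartanUp L h i k p * b h p :=
      Finset.sum_congr rfl fun r _ => mul_comm _ _
    rw [h4]
    field_simp
    field_simp at h3
    linear_combination h3
  rw [hL.angularForm_comm hp, IsFinslerOn.angularForm_eq_sum, vert_eq_sum Z]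
  simp only [map_sum, map_smul, smul_eq_mul, h1, Finset.mul_sum]
  refine Finset.sum_congr rfl fun k _ => ?_
  rw [hL.angularForm_comm hp]; ring

theorem fderiv_betaFun {p : Vec n × Vec n} (hp : p ∈ D) (w : Vec n × Vec n) :
    fderiv ℝ (betaFun b) p w = ∑ i, fderiv ℝ (b i) p w * p.2 i + ∑ i, b i p * w.2 i := by
  have hl := hasDerivAt_line p w
  have hp0 : p + (0 : ℝ) • w ∈ D := by simpa using hp
  have h1 := hasDerivAt_comp_of_contDiffOn hL.isOpen hb.contDiffOn_betaFun hp0 hl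
  have h2 := HasDerivAt.fun_sum (u := Finset.univ) fun i (_ : i ∈ Finset.univ) =>
    (hasDerivAt_comp_of_contDiffOn hL.isOpen (hb.smooth i) hp0 hl).mul
      (hasDerivAt_pi.1 hl.snd i)
  have := h1.unique h2
  simp only [zero_smul, add_zero] at this
  rw [this, Finset.sum_add_distrib]

/-- Because `h_ij y^i = 0`, the direction dependence of `b_i` does not enter the first vertical
derivative of `β`. -/
theorem sum_fderiv_vert_mul {p : Vec n × Vec n} (hp : p ∈ D) (Z : Vec n) :
    ∑ i, fderiv ℝ (b i) p (vert Z) * p.2 i = 0 := by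
  obtain ⟨κ, hκ⟩ := hb.exists_fderiv_vert hL
  have h := hL.angularForm_self hp Z
  rw [hL.angularForm_comm hp, IsFinslerOn.angularForm_eq_sum] at h
  simp only [hκ p hp]
  rw [← mul_zero (κ p), ← h, Finset.mul_sum]
  exact Finset.sum_congr rfl fun i _ => by ring

theorem fderiv_betaFun_vert {p : Vec n × Vec n} (hp : p ∈ D) (Z : Vec n) :
    fderiv ℝ (betaFun b) p (vert Z) = ∑ i, b i p * Z i := by
  rw [hb.fderiv_betaFun hL hp, hb.sum_fderiv_vert_mul hL hp, zero_add]; rfl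

theorem d2_betaFun {p : Vec n × Vec n} (hp : p ∈ D) (w : Vec n × Vec n) (Z : Vec n) :
    d2 (betaFun b) p w (vert Z) = ∑ i, fderiv ℝ (b i) p w * Z i := by
  have hl := hasDerivAt_line p w
  have hp0 : p + (0 : ℝ) • w ∈ D := by simpa using hp
  have h1 := hasDerivAt_d1_apply hL.isOpen hb.contDiffOn_betaFun hp0 hl
    (hasDerivAt_const 0 (vert Z))
  have h2 := HasDerivAt.fun_sum (u := Finset.univ) fun i (_ : i ∈ Finset.univ) =>
    (hasDerivAt_comp_of_contDiffOn hL.isOpen (hb.smooth i) hp0 hl).mul_const (Z i)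
  have := deriv_eq_of_eqOn hL.isOpen hl.continuousAt hp0
    (fun s hs => hb.fderiv_betaFun_vert hL hs Z) h1 h2
  simpa using this

theorem exists_d2_betaFun_vert : ∃ κ : Vec n × Vec n → ℝ, ∀ p ∈ D, ∀ Y Z,
    d2 (betaFun b) p (vert Y) (vert Z) = κ p * angularForm L p Y Z := by
  obtain ⟨κ, hκ⟩ := hb.exists_fderiv_vert hL
  refine ⟨κ, fun p hp Y Z => ?_⟩
  rw [hb.d2_betaFun hL hp, hL.angularForm_comm hp, IsFinslerOn.angularForm_eq_sum, Finset.mul_sum]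
  refine Finset.sum_congr rfl fun i _ => ?_
  rw [hκ p hp]; ring

/-- `β` satisfies the Euler-Lagrange equation along the spray of `L` if `b` is a gradient. -/
theorem euler_lagrange_betaFun (hgrad : ∀ p ∈ D, ∀ i j, hCov L b i j p = hCov L b j i p)
    {p : Vec n × Vec n} (hp : p ∈ D) (Z : Vec n) :
    d2 (betaFun b) p (sprayField L p) (vert Z) = fderiv ℝ (betaFun b) p (hor Z) := by
  -- In `b_{i|j} = b_{j|i}` the connection terms cancel by symmetry of `F^r_ij`.
  have hsymm : ∀ i j, fderiv ℝ (b i) p (hlift L p (Pi.single j 1)) =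
      fderiv ℝ (b j) p (hlift L p (Pi.single i 1)) := fun i j => by
    have hc : ∀ r j k, hConn L r j k p = hConnVec L p (Pi.single j 1) (Pi.single k 1) r :=
      fun r j k => by simp [hConnVec, Pi.single_apply]
    have h := hgrad p hp i j
    simp only [hCov, hL.delta_eq hp, hc] at h
    rw [hL.hConnVec_comm hp (Pi.single j 1)] at h
    linarith
  have hbil : ∀ V Z : Vec n, ∑ i, fderiv ℝ (b i) p (hlift L p V) * Z i =
      ∑ i, ∑ j, fderiv ℝ (b i) p (hlift L p (Pi.single j 1)) * V j * Z i := fun V Z => by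
    conv_lhs => rw [vec_eq_sum V]
    simp only [map_sum, map_smul, smul_eq_mul, Finset.sum_mul]
    exact Finset.sum_congr rfl fun i _ => Finset.sum_congr rfl fun j _ => by ring
  have hswap : ∑ i, fderiv ℝ (b i) p (hlift L p p.2) * Z i =
      ∑ i, fderiv ℝ (b i) p (hlift L p Z) * p.2 i := by
    rw [hbil, hbil, Finset.sum_comm]
    refine Finset.sum_congr rfl fun i _ => Finset.sum_congr rfl fun j _ => ?_
    rw [hsymm]; ring
  have hv := hb.sum_fderiv_vert_mul hL hp (nonlinMap L p Z)
  rw [hb.d2_betaFun hL hp, ← hL.hlift_self hp, hswap, hb.fderiv_betaFun hL hp]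
  simp only [hlift_apply, map_sub, sub_mul, Finset.sum_sub_distrib, hv]
  simp [hor_apply]

end IsHVectorOn

/-! ### Derivatives of the changed energy and the difference of the sprays. -/

variable (hb : IsHVectorOn D L b)

include hL hb

theorem contDiffOn_ratio : ContDiffOn ℝ ∞ (fun p => betaFun b p / L p) D :=
  hb.contDiffOn_betaFun.div hL.smooth fun p hp => (hL.pos p hp).ne'

theorem contDiffOn_changeP : ContDiffOn ℝ ∞ (changeP L (betaFun b)) D :=
  (contDiffOn_const.mul (contDiffOn_ratio hL hb)).exp.mul
    (contDiffOn_const.sub (contDiffOn_ratio hL hb))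

theorem contDiffOn_changeR : ContDiffOn ℝ ∞ (changeR L (betaFun b)) D :=
  hL.smooth.mul (contDiffOn_const.mul (contDiffOn_ratio hL hb)).exp

variable (hL' : IsFinslerOn D L')
  (hchange : ∀ p ∈ D, L' p = L p * Real.exp (betaFun b p / L p))

include hL' hchange

/-- Differentiate `E' = E e^{2β/L}` and eliminate `dL` by `L dL = dE`. Only `dE` and `dβ` remain,
and both vanish on normal vectors of a hypersurface to which `b` is tangential. -/
theorem fderiv_energy_change {p : Vec n × Vec n} (hp : p ∈ D) (w : Vec n × Vec n) :
    fderiv ℝ (energy L') p w = changeP L (betaFun b) p * fderiv ℝ (energy L) p w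
      + changeR L (betaFun b) p * fderiv ℝ (betaFun b) p w := by
  have h0 := (hL.pos p hp).ne'
  have hl := hasDerivAt_line p w
  have hp0 : p + (0 : ℝ) • w ∈ D := by simpa using hp
  have h0' : L (p + (0 : ℝ) • w) ≠ 0 := (hL.pos _ hp0).ne'
  have h1 := hasDerivAt_comp_of_contDiffOn hL.isOpen hL.smooth hp0 hl
  have h2 := hasDerivAt_comp_of_contDiffOn hL.isOpen hb.contDiffOn_betaFun hp0 hl
  have h3 := ((h1.mul (h2.div h1 h0').exp).pow 2).const_mul (1 / 2)
  have h4 := hasDerivAt_comp_of_contDiffOn hL.isOpen hL'.contDiffOn_energy hp0 hl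
  have h5 := deriv_eq_of_eqOn hL.isOpen hl.continuousAt hp0 (fun s hs => ?_) h4 h3
  · have he : Real.exp (2 * (betaFun b p / L p)) = Real.exp (betaFun b p / L p) ^ 2 := by
      rw [← Real.exp_nat_mul]; norm_num
    simp only [zero_smul, add_zero, Pi.mul_apply, Pi.div_apply] at h5
    rw [h5, hL.fderiv_energy hp, changeP, changeR, he]
    norm_num
    field_simp
    ring
  · rw [energy, hchange _ hs]; rfl

theorem d2_energy_change {p : Vec n × Vec n} (hp : p ∈ D) (v w : Vec n × Vec n) :
    d2 (energy L') p v w =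
      fderiv ℝ (changeP L (betaFun b)) p v * fderiv ℝ (energy L) p w
      + changeP L (betaFun b) p * d2 (energy L) p v w
      + (fderiv ℝ (changeR L (betaFun b)) p v * fderiv ℝ (betaFun b) p w
      + changeR L (betaFun b) p * d2 (betaFun b) p v w) := by
  have hl := hasDerivAt_line p v
  have hp0 : p + (0 : ℝ) • v ∈ D := by simpa using hp
  have hw := hasDerivAt_const (0 : ℝ) w
  have h1 := hasDerivAt_d1_apply hL.isOpen hL'.contDiffOn_energy hp0 hl hw
  have h2 := ((hasDerivAt_comp_of_contDiffOn hL.isOpen (contDiffOn_changeP hL hb) hp0 hl).mul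
    (hasDerivAt_d1_apply hL.isOpen hL.contDiffOn_energy hp0 hl hw)).add
    ((hasDerivAt_comp_of_contDiffOn hL.isOpen (contDiffOn_changeR hL hb) hp0 hl).mul
    (hasDerivAt_d1_apply hL.isOpen hb.contDiffOn_betaFun hp0 hl hw))
  have := deriv_eq_of_eqOn hL.isOpen hl.continuousAt hp0
    (fun s hs => fderiv_energy_change hL hb hL' hchange hs w) h1 h2
  simpa using this

/-- The difference of the sprays of `L e^{β/L}` and `L`. -/
theorem d2_spray_sub (hgrad : ∀ p ∈ D, ∀ i j, hCov L b i j p = hCov L b j i p)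
    {p : Vec n × Vec n} (hp : p ∈ D) (Z : Vec n) :
    2 * d2 (energy L') p (vert (sprayVec L' p - sprayVec L p)) (vert Z) =
      fderiv ℝ (changeP L (betaFun b)) p (sprayField L p) * fderiv ℝ (energy L) p (vert Z)
      + fderiv ℝ (changeR L (betaFun b)) p (sprayField L p)
        * fderiv ℝ (betaFun b) p (vert Z) := by
  have h1 := hL'.euler_lagrange hp Z
  have h2 := d2_energy_change hL hb hL' hchange hp (sprayField L p) (vert Z)
  -- The Euler-Lagrange equations of `E` and `β` turn the Hessian terms into `dE'` on `hor Z`, which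
  -- cancels against the Euler-Lagrange equation of `E'`.
  rw [hL.euler_lagrange hp, hb.euler_lagrange_betaFun hL hgrad hp] at h2
  rw [fderiv_energy_change hL hb hL' hchange hp] at h1
  have e : sprayField L p - sprayField L' p =
      (2 : ℝ) • vert (sprayVec L' p - sprayVec L p) := by
    simp only [sprayField, map_sub, smul_sub]; abel
  have h3 := congrArg (fun w => d2 (energy L') p w (vert Z)) e
  simp only [map_sub (d2 (energy L') p), map_smul (d2 (energy L') p), sub_apply, smul_apply,
    smul_eq_mul] at h3
  linarith

end Change


/-! ## Hypersurfaces under the `h`-exponential change -/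

section ChangeHypersurface

variable {m n : ℕ} {φ : Vec m → Vec n} {U : Set (Vec m)} {D : Set (Vec n × Vec n)}
  {L L' : Vec n × Vec n → ℝ} {b : Fin n → Vec n × Vec n → ℝ}

/-- The supporting element is itself tangential, and `dE(X) = g(X, y)`. -/
theorem IsNormalVec.fderiv_energy (hL : IsFinslerOn D L) {q : Vec m × Vec m}
    (hq : q ∈ liftDomain φ U D) {X : Vec n} (hX : IsNormalVec L φ q X) :
    fderiv ℝ (energy L) (lift φ q) (vert X) = 0 := by
  rw [← hL.d2_vert_vert_self hq.2, d2_comm hL.isOpen hL.contDiffOn_energy hq.2]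
  exact hX q.2

theorem IsNormalVec.angularForm_eq (hL : IsFinslerOn D L) {q : Vec m × Vec m}
    (hq : q ∈ liftDomain φ U D) {X : Vec n} (hX : IsNormalVec L φ q X) (Z : Vec n) :
    angularForm L (lift φ q) Z X =
      2 * energy L (lift φ q) * d2 (energy L) (lift φ q) (vert Z) (vert X) := by
  rw [angularForm, hX.fderiv_energy hL hq, mul_zero, sub_zero]

theorem IsNormalVec.fderiv_betaFun (hL : IsFinslerOn D L) (hb : IsHVectorOn D L b)
    (htan : IsTangentialOn L b φ (liftDomain φ U D)) {q : Vec m × Vec m}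
    (hq : q ∈ liftDomain φ U D) {X : Vec n} (hX : IsNormalVec L φ q X) :
    fderiv ℝ (betaFun b) (lift φ q) (vert X) = 0 := by
  refine IsImmersionOn.normal_induction hL hq
    (T := ((fderiv ℝ (betaFun b) (lift φ q)).comp vert).toLinearMap) (fun X hX => ?_) hX
  exact (hb.fderiv_betaFun_vert hL hq.2 X).trans (htan q hq X hX)

/-- The third vertical derivative of `β` in two tangential and one normal directions vanishes if
that of the energy does. -/
theorem IsNormalVec.d3_betaFun (hL : IsFinslerOn D L) (hb : IsHVectorOn D L b)
    {q : Vec m × Vec m} (hq : q ∈ liftDomain φ U D) {X : Vec n} (hX : IsNormalVec L φ q X)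
    {a c : Vec m} (hM : d3 (energy L) (lift φ q) (vert (fderiv ℝ φ q.1 a))
      (vert (fderiv ℝ φ q.1 c)) (vert X) = 0) :
    d3 (betaFun b) (lift φ q) (vert (fderiv ℝ φ q.1 a)) (vert (fderiv ℝ φ q.1 c)) (vert X) = 0 := by
  by_cases h0 : X = 0
  · rw [h0, map_zero, map_zero]
  have hE := hL.contDiffOn_energy
  obtain ⟨κ, hκ⟩ := hb.exists_d2_betaFun_vert hL
  set Y := fderiv ℝ φ q.1 a
  set Z := fderiv ℝ φ q.1 c
  have hl := hasDerivAt_line (lift φ q) (vert Y)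
  have hp0 : lift φ q + (0 : ℝ) • vert Y ∈ D := by simpa using hq.2
  have hc := fun V : Vec n => hasDerivAt_const (0 : ℝ) (vert V)
  have hβ := fun V W : Vec n =>
    hasDerivAt_d2_apply hL.isOpen hb.contDiffOn_betaFun hp0 hl (hc V) (hc W)
  have hang := fun V W : Vec n => (((hasDerivAt_comp_of_contDiffOn hL.isOpen hE hp0 hl).const_mul
    2).mul (hasDerivAt_d2_apply hL.isOpen hE hp0 hl (hc V) (hc W))).sub
    ((hasDerivAt_d1_apply hL.isOpen hE hp0 hl (hc V)).mul
      (hasDerivAt_d1_apply hL.isOpen hE hp0 hl (hc W)))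
  -- The factor `κ` is not known to be differentiable, so it is eliminated by cross multiplication:
  -- `D²β(Z,X) h(X,X) = D²β(X,X) h(Z,X)` is differentiated along `Y`. There `h(Z,X)` vanishes to
  -- first order, while `h(X,X)` is positive.
  have h := deriv_eq_of_eqOn hL.isOpen hl.continuousAt hp0 (fun s hs => ?_)
    ((hβ Z X).mul (hang X X)) ((hβ X X).mul (hang Z X))
  · have e1 := hX.fderiv_energy hL hq
    have e2 : d2 (energy L) (lift φ q) (vert Y) (vert X) = 0 := hX a
    have e3 : d2 (energy L) (lift φ q) (vert Z) (vert X) = 0 := hX c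
    have e4 : d2 (betaFun b) (lift φ q) (vert Z) (vert X) = 0 := by
      rw [hκ _ hq.2, hX.angularForm_eq hL hq, e3, mul_zero, mul_zero]
    have e5 := hL.d2_vert_pos hq.2 h0
    have e6 := hL.energy_pos hq.2
    simp only [zero_smul, add_zero, map_zero, zero_apply, Pi.mul_apply, Pi.sub_apply, e1, e2, e3,
      e4, hM, mul_zero, zero_mul, sub_zero] at h
    have h7 : 2 * energy L (lift φ q) * d2 (energy L) (lift φ q) (vert X) (vert X) ≠ 0 := by
      positivity
    exact (mul_eq_zero.1 h).resolve_right h7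
  · change d2 (betaFun b) _ (vert Z) (vert X) * angularForm L _ X X =
      d2 (betaFun b) _ (vert X) (vert X) * angularForm L _ Z X
    rw [hκ _ hs, hκ _ hs]; ring

variable (hφ : IsImmersionOn φ U) (hL : IsFinslerOn D L) (hb : IsHVectorOn D L b)
  (hL' : IsFinslerOn D L') (hchange : ∀ p ∈ D, L' p = L p * Real.exp (betaFun b p / L p))
  (htan : IsTangentialOn L b φ (liftDomain φ U D))

include hφ hL hb hL' hchange htan

omit hφ in
/-- The normal vectors of `L` are normal vectors of `L e^{β/L}`. -/
theorem IsNormalVec.change {q : Vec m × Vec m} (hq : q ∈ liftDomain φ U D) {X : Vec n}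
    (hX : IsNormalVec L φ q X) : IsNormalVec L' φ q X := by
  intro c
  obtain ⟨κ, hκ⟩ := hb.exists_d2_betaFun_vert hL
  rw [d2_energy_change hL hb hL' hchange hq.2, hκ _ hq.2, hX.angularForm_eq hL hq, hX c,
    hX.fderiv_energy hL hq, hX.fderiv_betaFun hL hb htan hq]
  ring

/-- Subtracting the tangential part `B c` leaves an `L`-normal vector, which is also `L'`-normal.
Hence `B c` is both tangential and `L'`-normal, so it is zero. -/
theorem IsNormalVec.of_change {q : Vec m × Vec m} (hq : q ∈ liftDomain φ U D) {X : Vec n}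
    (hX : IsNormalVec L' φ q X) : IsNormalVec L φ q X := by
  have hW := hφ.isNormalVec_sub_projVec hL hq X
  have hW' := hW.change hL hb hL' hchange htan hq
  set c := projVec L φ q X
  have h1 := hX c
  have h2 := hW' c
  have h3 : fderiv ℝ φ q.1 c = 0 := by
    refine hL'.eq_zero_of_d2_vert_self hq.2 ?_
    simp only [map_sub] at h2
    linarith
  rwa [h3, sub_zero] at hW

theorem IsFlatOn.change (hgrad : ∀ p ∈ D, ∀ i j, hCov L b i j p = hCov L b j i p)
    (hflat : IsFlatOn D L φ U) : IsFlatOn D L' φ U := by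
  have hE := hL.contDiffOn_energy
  have hE' := hL'.contDiffOn_energy
  obtain ⟨κ, hκ⟩ := hb.exists_d2_betaFun_vert hL
  have hβ2 : ∀ q ∈ liftDomain φ U D, ∀ X, IsNormalVec L φ q X → ∀ a,
      d2 (betaFun b) (lift φ q) (vert (fderiv ℝ φ q.1 a)) (vert X) = 0 := fun q hq X hX a => by
    rw [hκ _ hq.2, hX.angularForm_eq hL hq, hX a, mul_zero, mul_zero]
  have hM : ∀ q ∈ liftDomain φ U D, ∀ X, IsNormalVec L φ q X → ∀ a c,
      d3 (energy L') (lift φ q) (vert (fderiv ℝ φ q.1 a)) (vert (fderiv ℝ φ q.1 c))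
        (vert X) = 0 := by
    intro q hq X hX a c
    have hM0 := hflat.cartan_eq_zero q hq X hX a c
    have hβ3 := hX.d3_betaFun hL hb hq hM0
    have hβa := hβ2 q hq X hX a
    have hβc := hβ2 q hq X hX c
    have hβ1 := hX.fderiv_betaFun hL hb htan hq
    have hE1 := hX.fderiv_energy hL hq
    have hEa := hX a
    have hEc := hX c
    set Y := fderiv ℝ φ q.1 a
    set Z := fderiv ℝ φ q.1 c
    have hl := hasDerivAt_line (lift φ q) (vert Y)
    have hp0 : lift φ q + (0 : ℝ) • vert Y ∈ D := by simpa using hq.2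
    have hZ := hasDerivAt_const (0 : ℝ) (vert Z)
    have hX0 := hasDerivAt_const (0 : ℝ) (vert X)
    have hP := contDiffOn_changeP hL hb
    have hR := contDiffOn_changeR hL hb
    have h1 := hasDerivAt_d2_apply hL.isOpen hE' hp0 hl hZ hX0
    -- After differentiation every summand contains a first, second or third derivative of `E` or
    -- `β` with `X` in a slot and only tangential vectors in the others; all of these vanish.
    have h2 := (((hasDerivAt_d1_apply hL.isOpen hP hp0 hl hZ).mul
      (hasDerivAt_d1_apply hL.isOpen hE hp0 hl hX0)).add
      ((hasDerivAt_comp_of_contDiffOn hL.isOpen hP hp0 hl).mul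
        (hasDerivAt_d2_apply hL.isOpen hE hp0 hl hZ hX0))).add
      (((hasDerivAt_d1_apply hL.isOpen hR hp0 hl hZ).mul
      (hasDerivAt_d1_apply hL.isOpen hb.contDiffOn_betaFun hp0 hl hX0)).add
      ((hasDerivAt_comp_of_contDiffOn hL.isOpen hR hp0 hl).mul
        (hasDerivAt_d2_apply hL.isOpen hb.contDiffOn_betaFun hp0 hl hZ hX0)))
    have h := deriv_eq_of_eqOn hL.isOpen hl.continuousAt hp0
      (fun s hs => d2_energy_change hL hb hL' hchange hs (vert Z) (vert X)) h1 h2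
    simpa only [zero_smul, add_zero, map_zero, zero_apply, hM0, hβ3, hβa, hβc, hβ1, hE1, hEa, hEc,
      mul_zero] using h
  refine ⟨fun q hq a => ?_, fun q hq X hX a c =>
    hM q hq X (hX.of_change hφ hL hb hL' hchange htan hq) a c⟩
  -- The difference of the sprays is dual to a combination of `dE` and `dβ`, hence tangential.
  obtain ⟨c, hc⟩ := hφ.exists_fderiv_eq_of_normal hL' hq
    (W := sprayVec L' (lift φ q) - sprayVec L (lift φ q)) fun X hX' => by
      have hX := hX'.of_change hφ hL hb hL' hchange htan hq
      have h := d2_spray_sub hL hb hL' hchange hgrad hq.2 X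
      rw [hX.fderiv_energy hL hq, hX.fderiv_betaFun hL hb htan hq] at h
      linarith
  -- The relation `d2_spray_sub` is differentiated in the vertical direction `B a`, which turns the
  -- sprays into nonlinear connections. The derivative of the metric contributes `D³E'(B a, B c,
  -- X)`, which is zero because the spray difference is the tangential vector `B c`.
  obtain ⟨d, hd⟩ := hφ.exists_fderiv_eq_of_normal hL' hq
    (W := nonlinMap L' (lift φ q) (fderiv ℝ φ q.1 a) - nonlinMap L (lift φ q) (fderiv ℝ φ q.1 a))
    fun X hX' => by
      have hX := hX'.of_change hφ hL hb hL' hchange htan hq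
      have hMac := hM q hq X hX a c
      have hβa := hβ2 q hq X hX a
      have hβ1 := hX.fderiv_betaFun hL hb htan hq
      have hE1 := hX.fderiv_energy hL hq
      have hEa := hX a
      rw [hc] at hMac
      set Y := fderiv ℝ φ q.1 a
      have hl := hasDerivAt_line (lift φ q) (vert Y)
      have hp0 : lift φ q + (0 : ℝ) • vert Y ∈ D := by simpa using hq.2
      have hX0 := hasDerivAt_const (0 : ℝ) (vert X)
      have hS := hL.hasDerivAt_sprayField_line hq.2 (vert Y)
      have hG := vert.hasFDerivAt.comp_hasDerivAt (0 : ℝ)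
        ((hasDerivAt_comp_of_contDiffOn hL.isOpen hL'.contDiffOn_sprayVec hp0 hl).sub
          (hasDerivAt_comp_of_contDiffOn hL.isOpen hL.contDiffOn_sprayVec hp0 hl))
      have h1 := (hasDerivAt_d2_apply hL.isOpen hE' hp0 hl hG hX0).const_mul 2
      have h2 := ((hasDerivAt_d1_apply hL.isOpen (contDiffOn_changeP hL hb) hp0 hl hS).mul
        (hasDerivAt_d1_apply hL.isOpen hE hp0 hl hX0)).add
        ((hasDerivAt_d1_apply hL.isOpen (contDiffOn_changeR hL hb) hp0 hl hS).mul
        (hasDerivAt_d1_apply hL.isOpen hb.contDiffOn_betaFun hp0 hl hX0))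
      have h := deriv_eq_of_eqOn hL.isOpen hl.continuousAt hp0
        (fun s hs => d2_spray_sub hL hb hL' hchange hgrad hs X) h1 h2
      simp only [zero_smul, add_zero, map_zero, Function.comp_apply, Pi.sub_apply, hMac, hβa, hβ1,
        hE1, hEa, mul_zero, zero_add] at h
      exact (mul_eq_zero.1 h).resolve_left two_ne_zero
  obtain ⟨e, he⟩ := hflat.dirVec_tangent q hq a
  refine ⟨e + d, ?_⟩
  rw [map_add, he, hd, dirVec, dirVec]
  abel

end ChangeHypersurface


/-! ## Passage to charts -/

section Charts

variable {m n : ℕ}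
  {M : Type*} [TopologicalSpace M] [ChartedSpace (Vec n) M]
  {S : Type*} [TopologicalSpace S] [ChartedSpace (Vec m) S]

theorem localFun_hExpChange (e : OpenPartialHomeomorph M (Vec n))
    (L : TangentBundle 𝓘(ℝ, Vec n) M → ℝ)
    (b : (p : TangentBundle 𝓘(ℝ, Vec n) M) → TangentSpace 𝓘(ℝ, Vec n) p.proj →L[ℝ] ℝ)
    (p : Vec n × Vec n) : localFun e (hExpChange L b) p =
      localFun e L p * Real.exp (betaFun (localCovector e b) p / localFun e L p) := by
  have h : b (tangentOf e p) (tangentOf e p).snd = betaFun (localCovector e b) p := by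
    have hlin : ∀ T : Vec n →L[ℝ] ℝ, T p.2 = ∑ i, T (Pi.single i 1) * p.2 i := fun T => by
      conv_lhs => rw [vec_eq_sum p.2]
      simp only [map_sum, map_smul, smul_eq_mul]
      exact Finset.sum_congr rfl fun i _ => mul_comm _ _
    exact hlin ((b (tangentOf e p)).comp (mfderiv 𝓘(ℝ, Vec n) 𝓘(ℝ, Vec n) e.symm p.1))
  rw [localFun, hExpChange, h]; rfl

/-- By the chain rule the derivative is a composite of three injective maps, the outer two coming
from the charts. -/
theorem isImmersionOn_localMap {M : Type*} [TopologicalSpace M] [ChartedSpace (Vec (m + 1)) M]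
    [IsManifold 𝓘(ℝ, Vec (m + 1)) ∞ M] [IsManifold 𝓘(ℝ, Vec m) ∞ S] {f : S → M}
    (hf : IsHypersurface (m := m) f) {c : OpenPartialHomeomorph S (Vec m)}
    (hc : c ∈ smoothCharts m S) {e : OpenPartialHomeomorph M (Vec (m + 1))}
    (he : e ∈ smoothCharts (m + 1) M) :
    IsImmersionOn (localMap c e f) (localMapDomain c e f) := by
  have hO : IsOpen (localMapDomain c e f) :=
    c.isOpen_inter_preimage_symm (e.open_source.preimage hf.smooth.continuous)
  have hcs := contMDiffOn_symm_of_mem_maximalAtlas hc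
  have hcc := contMDiffOn_of_mem_maximalAtlas hc
  have hes := contMDiffOn_symm_of_mem_maximalAtlas he
  have hee := contMDiffOn_of_mem_maximalAtlas he
  refine ⟨hO, ?_, fun u hu => ?_⟩
  · rw [← contMDiffOn_iff_contDiffOn]
    exact hee.comp (hf.smooth.comp_contMDiffOn (hcs.mono fun u hu => hu.1)) fun u hu => hu.2
  · have hu1 : u ∈ c.target := hu.1
    have hu2 : f (c.symm u) ∈ e.source := hu.2
    have d1 : MDifferentiableAt 𝓘(ℝ, Vec m) 𝓘(ℝ, Vec m) c.symm u :=
      ((hcs u hu1).contMDiffAt (c.open_target.mem_nhds hu1)).mdifferentiableAt (by simp)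
    have d2 : MDifferentiableAt 𝓘(ℝ, Vec m) 𝓘(ℝ, Vec (m + 1)) f (c.symm u) :=
      (hf.smooth _).mdifferentiableAt (by simp)
    have d3 : MDifferentiableAt 𝓘(ℝ, Vec (m + 1)) 𝓘(ℝ, Vec (m + 1)) e (f (c.symm u)) :=
      ((hee _ hu2).contMDiffAt (e.open_source.mem_nhds hu2)).mdifferentiableAt (by simp)
    have hcm : c.MDifferentiable 𝓘(ℝ, Vec m) 𝓘(ℝ, Vec m) :=
      ⟨hcc.mdifferentiableOn (by simp), hcs.mdifferentiableOn (by simp)⟩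
    have hem : e.MDifferentiable 𝓘(ℝ, Vec (m + 1)) 𝓘(ℝ, Vec (m + 1)) :=
      ⟨hee.mdifferentiableOn (by simp), hes.mdifferentiableOn (by simp)⟩
    have hd : mfderiv 𝓘(ℝ, Vec m) 𝓘(ℝ, Vec (m + 1)) ((e ∘ f) ∘ c.symm) u = _ :=
      (mfderiv_comp u (d3.comp (c.symm u) d2) d1)
    rw [mfderiv_comp (c.symm u) d3 d2, mfderiv_eq_fderiv] at hd
    have hd' : fderiv ℝ (localMap c e f) u = _ := hd
    rw [hd']
    exact ((hem.mfderiv_injective hu2).comp (hf.immersion _)).comp (hcm.symm.mfderiv_injective hu1)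

end Charts

end HExpFinsler

end

theorem corollary5p1 {m : ℕ}
    {M : Type*} [TopologicalSpace M] [ChartedSpace (Vec (m + 1)) M]
    [IsManifold 𝓘(ℝ, Vec (m + 1)) ∞ M]
    {S : Type*} [TopologicalSpace S] [ChartedSpace (Vec m) S] [IsManifold 𝓘(ℝ, Vec m) ∞ S]
    (D : Set (TangentBundle 𝓘(ℝ, Vec (m + 1)) M))
    (L : TangentBundle 𝓘(ℝ, Vec (m + 1)) M → ℝ)
    (b : (p : TangentBundle 𝓘(ℝ, Vec (m + 1)) M) →
      TangentSpace 𝓘(ℝ, Vec (m + 1)) p.proj →L[ℝ] ℝ)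
    (f : S → M)
    (hL : IsFinsler D L)
    (hLandsberg : IsLandsberg D L)
    (hb : IsHVector D L b)
    (hL' : IsFinsler D (hExpChange L b))
    (hf : IsHypersurface (m := m) f)
    (hgrad : IsGradient D L b)
    (htan : IsTangential (m := m) D L b f) :
    (IsHyperplaneSecondKind (m := m) D L f → SecondVTensorVanishes (m := m) D L f →
      IsHyperplaneSecondKind (m := m) D (hExpChange L b) f) ∧
    (IsHyperplaneThirdKind (m := m) D L f → IsHyperplaneThirdKind (m := m) D (hExpChange L b) f) := by
  -- Flatness is transported separately in each pair of charts; no comparison between charts is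
  -- needed.
  have hflat : ∀ c ∈ smoothCharts m S, ∀ e ∈ smoothCharts (m + 1) M,
      IsFlatOn (localDomain e D) (localFun e L) (localMap c e f) (localMapDomain c e f) →
      IsFlatOn (localDomain e D) (localFun e (hExpChange L b)) (localMap c e f)
        (localMapDomain c e f) := fun c hc e he h =>
    h.change (isImmersionOn_localMap hf hc he) (hL e he) (hb e he) (hL' e he)
      (fun p _ => localFun_hExpChange e L b p) (htan c hc e he) (hgrad e he)
  constructor
  · intro h2 hM c hc e he
    have hφ := isImmersionOn_localMap hf hc he
    exact hφ.isSecondKindOn_of_isFlatOn (hL' e he) (hflat c hc e he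
      (hφ.isFlatOn_of_isSecondKindOn (hL e he) (h2 c hc e he) (hM c hc e he)))
  · intro h3 c hc e he
    have hφ := isImmersionOn_localMap hf hc he
    exact hφ.isThirdKindOn_of_isFlatOn (hL' e he) rfl (hflat c hc e he
      (hφ.isFlatOn_of_isThirdKindOn (hL e he) (h3 c hc e he)))
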